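/- Let $n\in\{6,8\}$ and let $f,g,h$ be meromorphic functions on $\mathbb C$, none of them identically zero, with $f^n+g^n+h^n=1$; regard $F=[f,g,h,1]$ as a holomorphic map $\mathbb C\to\mathbb P^3$. On $\mathbb C^3$ with coordinates $x,y,z$ put $D^2u=d^2u+\frac{n-1}{u}(du)^2$ for $u\in\{x,y,z\}$ and $$M_{xyz}=\begin{vmatrix}1&1&1\\ \frac{dx}{x}&\frac{dy}{y}&\frac{dz}{z}\\ \frac{D^2x}{x}&\frac{D^2y}{y}&\frac{D^2z}{z}\end{vmatrix},\qquad \Phi=\frac{dy\,D^2z-dz\,D^2y}{x^{n-1}};$$ on the surface $x^n+y^n+z^n=1$ the expression $\Phi$ is unchanged under cyclic permutations of $x,y,z$. The pull-backs $F^*M_{xyz}$ and $F^*(xyz\Phi)$ are the meromorphic functions of $\zeta\in\mathbb C$ obtained by substituting $f,g,h$ for $x,y,z$, the derivatives $f',g',h'$ for $dx,dy,dz$, and $f'',g'',h''$ for $d^2x,d^2y,d^2z$. For a holomorphic map $G:\mathbb C\to\mathbb P^m$ let $$T(r,G)=\int_0^r\frac{d\rho}{\rho}\int_{|\zeta|<\rho}G^*\omega,$$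 where $\omega$ is the Fubini–Study form, $\omega=\frac{i}{2\pi}\partial\bar\partial\log\bigl(1+\sum_i|w_i|^2\bigr)$ in affine coordinates; a meromorphic function $p$ is regarded as the map $[p,1]:\mathbb C\to\mathbb P^1$. Assume that $F^*M_{xyz}$ is not identically zero. (a) If $n=6$ and $f,g,h$ are entire, then there is a set $E\subset(0,\infty)$ with $\int_E\frac{dr}{r}<\infty$ such that $$T\bigl(r,F^*(xyz\Phi)\bigr)=O\bigl(\log T(r,F)\bigr)\qquad (r\to\infty,\ r\notin E).$$ (b) If $n=8$ (and $f,g,h$ are meromorphic), the same conclusion holds. -/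

import Mathlib

namespace FermatJet

/-- A `2`-jet on affine `3`-space with coordinates `x 0, x 1, x 2` (written `x, y, z` in the
informal text): the base point `x`, the values `dx` of the differentials `d x_j`, and the values
`d2x` of the second order differentials `d² x_j`. -/
structure TwoJet where
  x : Fin 3 → ℂ
  dx : Fin 3 → ℂ
  d2x : Fin 3 → ℂ

/-- The value of `D² x_j = d² x_j + ((n - 1) / x_j) (d x_j)²` on a `2`-jet. -/
noncomputable def D2 (n : ℕ) (j : TwoJet) (i : Fin 3) : ℂ :=
  j.d2x i + ((n : ℂ) - 1) / j.x i * j.dx i ^ 2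

/-- The meromorphic `2`-jet differential
`M_{xyz} = det (1, 1, 1; dx/x, dy/y, dz/z; D²x/x, D²y/y, D²z/z)`. -/
noncomputable def M (n : ℕ) (j : TwoJet) : ℂ :=
  Matrix.det
    !![1, 1, 1;
       j.dx 0 / j.x 0, j.dx 1 / j.x 1, j.dx 2 / j.x 2;
       D2 n j 0 / j.x 0, D2 n j 1 / j.x 1, D2 n j 2 / j.x 2]

/-- The meromorphic `2`-jet differential `Φ = (dy D²z - dz D²y) / x^(n-1)`.  On the Fermat surface
`x^n + y^n + z^n = 1` it is invariant under cyclic permutations of `x, y, z`, see `Phi_eq`. -/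
noncomputable def Phi (n : ℕ) (j : TwoJet) : ℂ :=
  Matrix.det !![j.dx 1, j.dx 2; D2 n j 1, D2 n j 2] / j.x 0 ^ (n - 1)

/-- On jets satisfying the first and second order equations obtained by differentiating
`x^n + y^n + z^n = 1`, the three quotients
`(dy D²z - dz D²y) / x^(n-1)`, `(dz D²x - dx D²z) / y^(n-1)`, `(dx D²y - dy D²x) / z^(n-1)`
agree, so that `Phi` is their common value. -/
theorem Phi_eq (n : ℕ) (j : TwoJet) (hx : ∀ i, j.x i ≠ 0)
    (h1 : ∑ i, j.x i ^ (n - 1) * j.dx i = 0)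
    (h2 : ∑ i, j.x i ^ (n - 1) * D2 n j i = 0) :
    Phi n j = Matrix.det !![j.dx 2, j.dx 0; D2 n j 2, D2 n j 0] / j.x 1 ^ (n - 1) ∧
    Phi n j = Matrix.det !![j.dx 0, j.dx 1; D2 n j 0, D2 n j 1] / j.x 2 ^ (n - 1) := by
  have e0 := pow_ne_zero (n - 1) (hx 0)
  have e1 := pow_ne_zero (n - 1) (hx 1)
  have e2 := pow_ne_zero (n - 1) (hx 2)
  simp only [Fin.sum_univ_three] at h1 h2
  simp only [Phi, Matrix.det_fin_two_of]
  constructor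
  · rw [div_eq_div_iff e0 e1]
    linear_combination D2 n j 2 * h1 - j.dx 2 * h2
  · rw [div_eq_div_iff e0 e2]
    linear_combination -D2 n j 1 * h1 + j.dx 1 * h2

/-- The `2`-jet differential `xyz Φ`. -/
noncomputable def xyzPhi (n : ℕ) (j : TwoJet) : ℂ :=
  j.x 0 * j.x 1 * j.x 2 * Phi n j

/-- The `2`-jet at `ζ` of the curve `ζ ↦ (F 0 ζ, F 1 ζ, F 2 ζ)`. -/
noncomputable def jetOf (F : Fin 3 → ℂ → ℂ) (ζ : ℂ) : TwoJet where
  x i := F i ζ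
  dx i := deriv (F i) ζ
  d2x i := deriv (deriv (F i)) ζ

/-- The pull-back `F^* ω`, a function of `ζ`, of a `2`-jet differential `ω` under
`F = [F 0, F 1, F 2, 1]`: the differential `d^k x_i` pulls back to the `k`-th derivative of `F i`.
For meromorphic `F i` it has its mathematical meaning off a closed discrete set. -/
noncomputable def pullback (F : Fin 3 → ℂ → ℂ) (ω : TwoJet → ℂ) (ζ : ℂ) : ℂ :=
  ω (jetOf F ζ)

/-- Density with respect to the Lebesgue measure of the plane of the pull-back of the Fubini-Study
form `(i / 2π) ∂∂̄ log (1 + ∑ |w_i|²)` of projective space under the curve `[F 1, …, F m, 1]`: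
`(1/π) ((1 + ∑ |F i|²) (∑ |F i'|²) - |∑ conj (F i) F i'|²) / (1 + ∑ |F i|²)²`.
The curve extends holomorphically over the poles of the `F i`, and the pull-back of the form extends
smoothly; the poles form a countable set, so they do not matter for integrals. -/
noncomputable def fubiniStudyDensity {ι : Type*} [Fintype ι] (F : ι → ℂ → ℂ) (ζ : ℂ) : ℝ :=
  ((1 + ∑ i, ‖F i ζ‖ ^ 2) * (∑ i, ‖deriv (F i) ζ‖ ^ 2)
      - ‖∑ i, (starRingEnd ℂ) (F i ζ) * deriv (F i) ζ‖ ^ 2)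
    / (Real.pi * (1 + ∑ i, ‖F i ζ‖ ^ 2) ^ 2)

/-- The characteristic function
`T(r, F) = ∫_0^r (dρ / ρ) ∫_{|ζ| < ρ} F^* ω_FS` of the curve `F = [F 1, …, F m, 1]`. -/
noncomputable def charT {ι : Type*} [Fintype ι] (F : ι → ℂ → ℂ) (r : ℝ) : ℝ :=
  ∫ ρ in (0 : ℝ)..r, (∫ ζ in Metric.ball (0 : ℂ) ρ, fubiniStudyDensity F ζ) / ρ

/-- The characteristic function `T(r, p)` of a meromorphic function `p`, regarded as the map
`[p, 1]` to the projective line. -/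
noncomputable def charTFun (p : ℂ → ℂ) (r : ℝ) : ℝ :=
  charT (fun _ : Fin 1 => p) r

/-- `u(r) = O(v(r))` as `r → ∞` for `r` outside a set of finite measure with respect to `dr / r`. -/
def IsBigOOutside (u v : ℝ → ℝ) : Prop :=
  ∃ E : Set ℝ, MeasurableSet E ∧ E ⊆ Set.Ioi 0 ∧ (∫⁻ r in E, ENNReal.ofReal (1 / r)) < ⊤ ∧
    Asymptotics.IsBigO (Filter.atTop ⊓ Filter.principal Eᶜ) u v

end FermatJet

open MeasureTheory Set Filter Topology Real Laplacian

/-! ### Integrals over discs and circle averages -/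

/-! The pull-back of $xyz\Phi$ has no poles, and its size is controlled by quantities whose
proximity functions are small; hence its characteristic function, which for an entire function is a
circle average up to a constant, is small.

Holomorphy. Multiplication by $xyz$ turns $\Phi$ into a polynomial in the jet divided by $x^{n-2}$,
and by cyclic symmetry also by $y^{n-2}$ or $z^{n-2}$. At a finite point the equation forbids that
all three coordinates vanish. At a pole one passes to a chart at infinity: the numerator acquires a
factor $w^{-6}$, which cancels against $w^{-(n-2)}$ exactly when $n=8$. The key lemmas are
`exists_analyticAt_of_analyticAt`, `fermatWedge_inv` and `exists_extension_at_pole`.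

Smallness. If $q\ge 0$ is continuous, concavity of the logarithm and two applications of Borel's
growth lemma bound the circle average of $\log(1+q)$ by a multiple of the logarithm of
$\int_0^r\frac{d\rho}{\rho}\int_{|\zeta|<\rho}q$ plus a constant, off a set of finite logarithmic
measure (`SmallOutside.circleAverage_log`). When $q$ is built from Laplacians, Jensen's formula
(`logIntegral_laplacian`) bounds that integral by a multiple of $T(r,F)$ and a small error. No
Nevanlinna theory of divisors is needed.

For $n=6$ the densities come from $u=\log(1+|F|^2)$, and the outcome is the lemma on the logarithmic
derivative for $|F'|^2/(1+|F|^2)$ and then, applied to the curve $(F,F')$, for $|F''|^2/(1+|F|^2)$.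
For $n=8$ poles are allowed, and affine derivatives are replaced by the Fubini–Study densities of
$F$ and of its first associated curve (`exists_fsDensity_associatedCurve_extension`).

Comparison. Divide by the power of the largest coordinate, which is bounded below on the surface.
The numerator consists of $2\times2$ minors and derivatives, so $|xyz\Phi|^2$ is at most a constant
times $(1+\theta)(1+\eta)^3$, with $\eta,\theta$ the first and second order quantities above.
Nonvanishing of $M_{xyz}$ makes $F$ nonconstant, so $T(r,F)\to\infty$ and additive constants are
absorbed. -/

/-- The integral of a continuous function over a disc, in polar coordinates. -/
theorem setIntegral_ball_eq_circleAverage {q : ℂ → ℝ} (hq : Continuous q) {r : ℝ} (hr : 0 ≤ r) :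
    ∫ ζ in Metric.ball (0 : ℂ) r, q ζ
      = ∫ t in (0 : ℝ)..r, t * (2 * π * circleAverage q 0 t) := by
  have hsymm : ∀ p : ℝ × ℝ, (Complex.polarCoord.symm p : ℂ) = circleMap 0 p.1 p.2 := by
    intro p
    rw [Complex.polarCoord_symm_apply, circleMap, Complex.exp_mul_I]
    push_cast
    ring
  have hcont : Continuous fun p : ℝ × ℝ => p.1 * q (circleMap 0 p.1 p.2) := by
    unfold circleMap
    fun_prop
  rw [← integral_indicator Metric.isOpen_ball.measurableSet,
    ← Complex.integral_comp_polarCoord_symm, polarCoord_target]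
  have h1 : ∫ p in Ioi (0 : ℝ) ×ˢ Ioo (-π) π,
      p.1 • (Metric.ball (0 : ℂ) r).indicator q (Complex.polarCoord.symm p)
      = ∫ p in Ioo (0 : ℝ) r ×ˢ Ioo (-π) π, p.1 * q (circleMap 0 p.1 p.2) := by
    rw [← integral_indicator (measurableSet_Ioi.prod measurableSet_Ioo),
      ← integral_indicator (measurableSet_Ioo.prod measurableSet_Ioo)]
    congr 1
    ext p
    simp only [indicator, mem_prod, mem_Ioi, hsymm, Metric.mem_ball, dist_zero_right,
      norm_circleMap_zero, mem_Ioo, smul_eq_mul]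
    by_cases h0 : 0 < p.1
    · by_cases h2 : p.1 < r
      · simp [h0, h2, abs_of_pos h0]
      · simp [h0, h2, abs_of_pos h0]
    · simp [h0]
  rw [h1, Measure.volume_eq_prod, setIntegral_prod]
  · rw [intervalIntegral.integral_of_le hr, integral_Ioc_eq_integral_Ioo]
    refine setIntegral_congr_fun measurableSet_Ioo fun t _ => ?_
    simp only
    rw [integral_const_mul]
    congr 1
    rw [← integral_Ioc_eq_integral_Ioo, ← intervalIntegral.integral_of_le (by linarith [pi_pos])]
    have hper : Function.Periodic (fun θ : ℝ => q (circleMap 0 t θ)) (2 * π) := fun θ => by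
      simp only [periodic_circleMap 0 t θ]
    have := hper.intervalIntegral_add_eq (-π) 0
    rw [show -π + 2 * π = π by ring, zero_add] at this
    rw [this, circleAverage, smul_eq_mul, ← mul_assoc, mul_inv_cancel₀ (by positivity), one_mul]
  · rw [← Measure.volume_eq_prod]
    exact (hcont.continuousOn.integrableOn_compact (isCompact_Icc.prod isCompact_Icc)).mono_set
      (prod_mono Ioo_subset_Icc_self Ioo_subset_Icc_self)

/-- The integral of `q` over the disc of radius `r`, as a function of `r ∈ ℝ`. -/
noncomputable def discIntegral (q : ℂ → ℝ) (r : ℝ) : ℝ :=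
  ∫ t in (0 : ℝ)..r, t * (2 * π * circleAverage q 0 t)

/-- The logarithmically weighted average `∫_0^r (∫_{|ζ| < ρ} q) dρ / ρ`. -/
noncomputable def logIntegral (q : ℂ → ℝ) (r : ℝ) : ℝ :=
  ∫ ρ in (0 : ℝ)..r, discIntegral q ρ / ρ

theorem hasDerivAt_discIntegral {q : ℂ → ℝ} (hq : Continuous q) (r : ℝ) :
    HasDerivAt (discIntegral q) (r * (2 * π * circleAverage q 0 r)) r :=
  (Continuous.integral_hasStrictDerivAt (by fun_prop) 0 r).hasDerivAt

theorem continuous_discIntegral {q : ℂ → ℝ} (hq : Continuous q) : Continuous (discIntegral q) :=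
  continuous_iff_continuousAt.2 fun r => (hasDerivAt_discIntegral hq r).continuousAt

theorem continuous_discIntegral_div {q : ℂ → ℝ} (hq : Continuous q) :
    Continuous fun r => discIntegral q r / r := by
  refine continuous_iff_continuousAt.2 fun r => ?_
  rcases eq_or_ne r 0 with rfl | hr
  · have h := (hasDerivAt_discIntegral hq 0).tendsto_slope
    rw [zero_mul] at h
    refine continuousAt_iff_punctured_nhds.2 ?_
    -- The default value of the quotient at $0$ is $0$, which is also the derivative of
    -- `discIntegral q` there, so no correction is needed.
    simp only [div_zero]
    refine h.congr fun t => ?_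
    simp [slope_def_field, discIntegral]
  · exact ((continuous_discIntegral hq).continuousAt).div continuousAt_id hr

theorem hasDerivAt_logIntegral {q : ℂ → ℝ} (hq : Continuous q) (r : ℝ) :
    HasDerivAt (logIntegral q) (discIntegral q r / r) r :=
  (Continuous.integral_hasStrictDerivAt (continuous_discIntegral_div hq) 0 r).hasDerivAt

theorem logIntegral_eq {q : ℂ → ℝ} (hq : Continuous q) {r : ℝ} (hr : 0 ≤ r) :
    logIntegral q r = ∫ ρ in (0 : ℝ)..r, (∫ ζ in Metric.ball (0 : ℂ) ρ, q ζ) / ρ := by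
  refine intervalIntegral.integral_congr fun ρ hρ => ?_
  rw [uIcc_of_le hr] at hρ
  simp only [setIntegral_ball_eq_circleAverage hq hρ.1, discIntegral]

theorem circleIntegrable_of_continuous {q : ℂ → ℝ} (hq : Continuous q) (r : ℝ) :
    CircleIntegrable q 0 r :=
  hq.continuousOn.circleIntegrable'

theorem circleAverage_mono_of_continuous {p q : ℂ → ℝ} (hp : Continuous p) (hq : Continuous q)
    (h : ∀ z, p z ≤ q z) (r : ℝ) : circleAverage p 0 r ≤ circleAverage q 0 r :=
  circleAverage_mono (circleIntegrable_of_continuous hp r) (circleIntegrable_of_continuous hq r)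
    fun z _ => h z

theorem circleAverage_nonneg_of_nonneg' {q : ℂ → ℝ} (h : ∀ z, 0 ≤ q z) (r : ℝ) :
    0 ≤ circleAverage q 0 r :=
  circleAverage_nonneg_of_nonneg fun z _ => h z

theorem discIntegral_nonneg {q : ℂ → ℝ} (h : ∀ z, 0 ≤ q z) {r : ℝ} (hr : 0 ≤ r) :
    0 ≤ discIntegral q r :=
  intervalIntegral.integral_nonneg hr fun t ht =>
    mul_nonneg ht.1 (mul_nonneg (by positivity) (circleAverage_nonneg_of_nonneg' h t))

theorem logIntegral_nonneg {q : ℂ → ℝ} (h : ∀ z, 0 ≤ q z) {r : ℝ} (hr : 0 ≤ r) :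
    0 ≤ logIntegral q r :=
  intervalIntegral.integral_nonneg hr fun _ ht => div_nonneg (discIntegral_nonneg h ht.1) ht.1

theorem discIntegral_mono {p q : ℂ → ℝ} (hp : Continuous p) (hq : Continuous q)
    (h : ∀ z, p z ≤ q z) {r : ℝ} (hr : 0 ≤ r) : discIntegral p r ≤ discIntegral q r := by
  refine intervalIntegral.integral_mono_on hr (Continuous.intervalIntegrable (by fun_prop) _ _)
    (Continuous.intervalIntegrable (by fun_prop) _ _) fun t ht => ?_
  have := circleAverage_mono_of_continuous hp hq h t
  have := ht.1
  gcongr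

theorem logIntegral_mono {p q : ℂ → ℝ} (hp : Continuous p) (hq : Continuous q)
    (h : ∀ z, p z ≤ q z) {r : ℝ} (hr : 0 ≤ r) : logIntegral p r ≤ logIntegral q r :=
  intervalIntegral.integral_mono_on hr
    ((continuous_discIntegral_div hp).intervalIntegrable _ _)
    ((continuous_discIntegral_div hq).intervalIntegrable _ _) fun _ ht =>
    div_le_div_of_nonneg_right (discIntegral_mono hp hq h ht.1) ht.1

theorem logIntegral_add {p q : ℂ → ℝ} (hp : Continuous p) (hq : Continuous q) (r : ℝ) :
    logIntegral (fun z => p z + q z) r = logIntegral p r + logIntegral q r := by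
  have hd : ∀ t, discIntegral (fun z => p z + q z) t = discIntegral p t + discIntegral q t := by
    intro t
    rw [discIntegral, discIntegral, discIntegral, ← intervalIntegral.integral_add
      (Continuous.intervalIntegrable (by fun_prop) _ _)
      (Continuous.intervalIntegrable (by fun_prop) _ _)]
    congr 1
    ext s
    rw [circleAverage_fun_add (circleIntegrable_of_continuous hp s)
      (circleIntegrable_of_continuous hq s)]
    ring
  simp only [logIntegral, hd, add_div]
  exact intervalIntegral.integral_add ((continuous_discIntegral_div hp).intervalIntegrable _ _)
    ((continuous_discIntegral_div hq).intervalIntegrable _ _)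

theorem logIntegral_const_mul (c : ℝ) (q : ℂ → ℝ) (r : ℝ) :
    logIntegral (fun z => c * q z) r = c * logIntegral q r := by
  have hd : ∀ t, discIntegral (fun z => c * q z) t = c * discIntegral q t := by
    intro t
    rw [discIntegral, discIntegral, ← intervalIntegral.integral_const_mul]
    congr 1
    ext s
    have := circleAverage_fun_smul (f := q) (c := 0) (R := s) (a := c)
    simp only [smul_eq_mul] at this
    rw [this]
    ring
  simp only [logIntegral, hd, mul_div_assoc]
  exact intervalIntegral.integral_const_mul _ _

/-! ### Jensen's formula for functions of class `C²` -/

/-- Differentiation under the integral sign over a compact interval. -/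
theorem hasDerivAt_intervalIntegral_param {f f' : ℝ → ℝ → ℝ} {a b : ℝ}
    (hf : ∀ s, Continuous (f s)) (hf' : Continuous (Function.uncurry f'))
    (h : ∀ s t, HasDerivAt (fun s => f s t) (f' s t) s) (s : ℝ) :
    HasDerivAt (fun s => ∫ t in a..b, f s t) (∫ t in a..b, f' s t) s := by
  obtain ⟨C, hC⟩ := ((isCompact_Icc (a := s - 1) (b := s + 1)).prod
    (isCompact_uIcc (a := a) (b := b))).exists_bound_of_continuousOn hf'.continuousOn
  refine (intervalIntegral.hasDerivAt_integral_of_dominated_loc_of_deriv_le (𝕜 := ℝ)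
    (s := Icc (s - 1) (s + 1)) (bound := fun _ => C) (Icc_mem_nhds (by linarith) (by linarith))
    (Eventually.of_forall fun s => (hf s).aestronglyMeasurable)
    ((hf s).intervalIntegrable _ _)
    (hf'.comp (Continuous.prodMk_right s)).aestronglyMeasurable ?_
    (continuous_const.intervalIntegrable _ _) ?_).2
  · exact Eventually.of_forall fun t ht x hx => hC (x, t) ⟨hx, uIoc_subset_uIcc ht⟩
  · exact Eventually.of_forall fun t _ x _ => h x t

theorem laplacian_apply (φ : ℂ → ℝ) (z : ℂ) :
    Δ φ z = fderiv ℝ (fderiv ℝ φ) z 1 1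
      + fderiv ℝ (fderiv ℝ φ) z Complex.I Complex.I := by
  rw [InnerProductSpace.laplacian_eq_iteratedFDeriv_complexPlane]
  simp [iteratedFDeriv_two_apply]

theorem continuous_laplacian {φ : ℂ → ℝ} (hφ : ContDiff ℝ 2 φ) : Continuous (Δ φ) := by
  have h2 : Continuous (fderiv ℝ (fderiv ℝ φ)) :=
    ((hφ.fderiv_right (m := 1) (by norm_num)).continuous_fderiv (by norm_num))
  have : Δ φ = fun z => fderiv ℝ (fderiv ℝ φ) z 1 1
      + fderiv ℝ (fderiv ℝ φ) z Complex.I Complex.I := funext (laplacian_apply φ)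
  rw [this]
  fun_prop

/-- **Jensen's formula** for a function of class `C²`. -/
theorem logIntegral_laplacian {φ : ℂ → ℝ} (hφ : ContDiff ℝ 2 φ) {r : ℝ} (hr : 0 ≤ r) :
    logIntegral (Δ φ) r = 2 * π * (circleAverage φ 0 r - φ 0) := by
  have hc := hφ.continuous
  have hφ1 : ContDiff ℝ 1 (fderiv ℝ φ) := hφ.fderiv_right (by norm_num)
  have hc1 : Continuous (fderiv ℝ φ) := hφ1.continuous
  have hc2 : Continuous (fderiv ℝ (fderiv ℝ φ)) := hφ1.continuous_fderiv (by norm_num)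
  have hcl : Continuous (Δ φ) := continuous_laplacian hφ
  have hd : ∀ z, HasFDerivAt φ (fderiv ℝ φ z) z := fun z =>
    (hφ.differentiable (by norm_num) z).hasFDerivAt
  have hd1 : ∀ z, HasFDerivAt (fderiv ℝ φ) (fderiv ℝ (fderiv ℝ φ) z) z := fun z =>
    (hφ1.differentiable (by norm_num) z).hasFDerivAt
  set e : ℝ → ℂ := fun θ => circleMap 0 1 θ with he
  have hec : Continuous e := by simp only [he]; fun_prop
  have hm : ∀ s θ : ℝ, circleMap 0 s θ = (s : ℂ) * e θ := by intro s θ; simp [he, circleMap]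
  have hds : ∀ s θ : ℝ, HasDerivAt (fun s : ℝ => (s : ℂ) * e θ) (e θ) s := by
    intro s θ
    simpa using (Complex.ofRealCLM.hasDerivAt (x := s)).mul_const (e θ)
  have hde : ∀ θ : ℝ, HasDerivAt e (e θ * Complex.I) θ := by
    intro θ
    simpa [he] using hasDerivAt_circleMap 0 1 θ
  have hdθ : ∀ s θ : ℝ, HasDerivAt (fun θ : ℝ => (s : ℂ) * e θ) (s * (e θ * Complex.I)) θ :=
    fun s θ => (hde θ).const_mul _
  -- the circle integral of `φ` and its radial derivative
  have h1 : ∀ s : ℝ, HasDerivAt (fun s : ℝ => ∫ θ in (0 : ℝ)..2 * π, φ (s * e θ))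
      (∫ θ in (0 : ℝ)..2 * π, fderiv ℝ φ (s * e θ) (e θ)) s := by
    refine hasDerivAt_intervalIntegral_param (fun s => by fun_prop) ?_ ?_
    · simp only [Function.uncurry_def]; fun_prop
    · exact fun s θ => (hd _).comp_hasDerivAt s (hds s θ)
  have h2 : ∀ s : ℝ, HasDerivAt (fun s : ℝ => ∫ θ in (0 : ℝ)..2 * π, s * fderiv ℝ φ (s * e θ) (e θ))
      (∫ θ in (0 : ℝ)..2 * π, (fderiv ℝ φ (s * e θ) (e θ)
        + s * fderiv ℝ (fderiv ℝ φ) (s * e θ) (e θ) (e θ))) s := by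
    refine hasDerivAt_intervalIntegral_param (fun s => by fun_prop) ?_ ?_
    · simp only [Function.uncurry_def]; fun_prop
    · intro s θ
      refine ((hasDerivAt_id' s).fun_mul
        (((hd1 _).comp_hasDerivAt s (hds s θ)).clm_apply (hasDerivAt_const s (e θ)))).congr_deriv ?_
      simp
  -- The integrand is the angular derivative of the tangential derivative of $\varphi$, so
  -- periodicity makes the integral vanish. This removes the angular part of the polar Laplacian.
  have h3 : ∀ s : ℝ, ∫ θ in (0 : ℝ)..2 * π,
      (s * fderiv ℝ (fderiv ℝ φ) (s * e θ) (e θ * Complex.I) (e θ * Complex.I)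
        - fderiv ℝ φ (s * e θ) (e θ)) = 0 := by
    intro s
    have hderiv : ∀ θ : ℝ, HasDerivAt (fun θ : ℝ => fderiv ℝ φ (s * e θ) (e θ * Complex.I))
        (s * fderiv ℝ (fderiv ℝ φ) (s * e θ) (e θ * Complex.I) (e θ * Complex.I)
          - fderiv ℝ φ (s * e θ) (e θ)) θ := by
      intro θ
      have := ((hd1 _).comp_hasDerivAt θ (hdθ s θ)).clm_apply ((hde θ).mul_const Complex.I)
      refine this.congr_deriv ?_
      have e1 : (s : ℂ) * (e θ * Complex.I) = s • (e θ * Complex.I) := by simp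
      have e2 : e θ * Complex.I * Complex.I = - e θ := by
        rw [mul_assoc, Complex.I_mul_I]; ring
      rw [e1, e2, map_smul, smul_apply, map_neg, smul_eq_mul, sub_eq_add_neg]
      rfl
    rw [intervalIntegral.integral_eq_sub_of_hasDerivAt (fun θ _ => hderiv θ)
      (Continuous.intervalIntegrable (by fun_prop) _ _)]
    have : e (2 * π) = e 0 := by
      have := periodic_circleMap 0 1 0
      simpa [he] using this
    rw [this, sub_self]
  -- The trace of the Hessian may be computed in the rotated orthonormal basis of radial and
  -- tangential directions.
  have hrot : ∀ s θ : ℝ, Δ φ (s * e θ) = fderiv ℝ (fderiv ℝ φ) (s * e θ) (e θ) (e θ)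
      + fderiv ℝ (fderiv ℝ φ) (s * e θ) (e θ * Complex.I) (e θ * Complex.I) := by
    intro s θ
    have e1 : e θ = cos θ • (1 : ℂ) + sin θ • Complex.I := by
      simp [he, circleMap, Complex.exp_mul_I]
    have e2 : e θ * Complex.I = -sin θ • (1 : ℂ) + cos θ • Complex.I := by
      rw [e1]; simp only [Complex.real_smul, Complex.ofReal_neg]; linear_combination (sin θ : ℂ) * Complex.I_mul_I
    rw [laplacian_apply]
    generalize fderiv ℝ (fderiv ℝ φ) (s * e θ) = B
    rw [e2, e1]
    simp only [map_add, map_smul, add_apply, smul_apply,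
      smul_eq_mul]
    linear_combination -(B 1 1 + B Complex.I Complex.I) * (sin_sq_add_cos_sq θ)
  -- The divergence theorem on the disc: both sides vanish at $0$ and have the same derivative.
  have h4 : ∀ s : ℝ, (∫ θ in (0 : ℝ)..2 * π, s * fderiv ℝ φ (s * e θ) (e θ)) = discIntegral (Δ φ) s := by
    have key : ∀ s : ℝ, HasDerivAt (fun s : ℝ => (∫ θ in (0 : ℝ)..2 * π, s * fderiv ℝ φ (s * e θ) (e θ))
        - discIntegral (Δ φ) s) 0 s := by
      intro s
      refine ((h2 s).sub (hasDerivAt_discIntegral hcl s)).congr_deriv ?_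
      rw [sub_eq_zero, circleAverage, smul_eq_mul, ← mul_assoc (2 * π),
        mul_inv_cancel₀ (by positivity), one_mul, ← intervalIntegral.integral_const_mul,
        ← sub_eq_zero, ← intervalIntegral.integral_sub
          (Continuous.intervalIntegrable (by fun_prop) _ _)
          (Continuous.intervalIntegrable (by fun_prop) _ _), ← neg_eq_zero,
        ← intervalIntegral.integral_neg]
      refine Eq.trans (intervalIntegral.integral_congr fun θ _ => ?_) (h3 s)
      rw [hm, hrot]
      ring
    intro s
    have := is_const_of_deriv_eq_zero (fun s => (key s).differentiableAt) (fun s => (key s).deriv) s 0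
    simp only [zero_mul, intervalIntegral.integral_zero, discIntegral,
      intervalIntegral.integral_same, sub_zero] at this
    rw [discIntegral]
    linarith
  have h5 : ∀ s ∈ Ioo 0 r, HasDerivAt (fun s : ℝ => ∫ θ in (0 : ℝ)..2 * π, φ (s * e θ))
      (discIntegral (Δ φ) s / s) s := by
    intro s hs
    refine (h1 s).congr_deriv ?_
    rw [← h4, intervalIntegral.integral_const_mul, mul_div_cancel_left₀ _ hs.1.ne']
  rw [logIntegral, intervalIntegral.integral_eq_sub_of_hasDerivAt_of_le hr ?_ h5
    ((continuous_discIntegral_div hcl).intervalIntegrable _ _)]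
  · simp only [circleAverage, hm, smul_eq_mul, mul_sub]
    rw [← mul_assoc, mul_inv_cancel₀ (by positivity), one_mul]
    simp
  · exact (continuous_iff_continuousAt.2 fun s => (h1 s).continuousAt).continuousOn

/-! ### Growth lemmas and exceptional sets -/

/-- A measurable subset of `(0, ∞)` of finite logarithmic measure. -/
def IsLogSmall (E : Set ℝ) : Prop :=
  MeasurableSet E ∧ E ⊆ Ioi 0 ∧ (∫⁻ r in E, ENNReal.ofReal (1 / r)) < ⊤

theorem IsLogSmall.empty : IsLogSmall ∅ := ⟨MeasurableSet.empty, empty_subset _, by simp⟩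

theorem IsLogSmall.union {E E' : Set ℝ} (h : IsLogSmall E) (h' : IsLogSmall E') :
    IsLogSmall (E ∪ E') :=
  ⟨h.1.union h'.1, union_subset h.2.1 h'.2.1,
    (lintegral_union_le _ _ _).trans_lt (ENNReal.add_lt_top.2 ⟨h.2.2, h'.2.2⟩)⟩

/-- **Borel's growth lemma**, for exceptional sets of finite logarithmic measure. -/
theorem isLogSmall_growth {y y' : ℝ → ℝ} (hy : ∀ r, HasDerivAt y (y' r) r)
    (hy' : ∀ r, 0 ≤ r → 0 ≤ y' r) (hm : Measurable y') (h1 : ∀ r, 0 ≤ r → 1 ≤ y r) :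
    IsLogSmall {r | 1 < r ∧ y r ^ 2 < r * y' r} := by
  have hyc : Continuous y := continuous_iff_continuousAt.2 fun r => (hy r).continuousAt
  have hmeas : MeasurableSet {r | 1 < r ∧ y r ^ 2 < r * y' r} :=
    measurableSet_Ioi.inter (measurableSet_lt (hyc.measurable.pow_const 2) (measurable_id.mul hm))
  refine ⟨hmeas, fun r hr => lt_trans one_pos hr.1, ?_⟩
  have hpos : ∀ r, 0 ≤ r → 0 < y r := fun r hr => one_pos.trans_le (h1 r hr)
  have hmono : MonotoneOn y (Ici 0) := by
    refine monotoneOn_of_deriv_nonneg (convex_Ici 0) hyc.continuousOn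
      (fun r _ => (hy r).differentiableAt.differentiableWithinAt) fun r hr => ?_
    rw [(hy r).deriv]
    exact hy' r (interior_subset hr)
  -- Truncation at $1$ gives a monotone function on the whole line, although `y` is controlled only
  -- for $r\ge 0$.
  have hg : Monotone fun r => -(y (max 1 r))⁻¹ := by
    intro a b hab
    have ha : (0 : ℝ) ≤ max 1 a := zero_le_one.trans (le_max_left _ _)
    have hb : (0 : ℝ) ≤ max 1 b := zero_le_one.trans (le_max_left _ _)
    exact neg_le_neg (inv_anti₀ (hpos _ ha) (hmono ha hb (max_le_max_left 1 hab)))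
  have hbdd : BddAbove (range fun r => -(y (max 1 r))⁻¹) := by
    refine ⟨0, ?_⟩
    rintro _ ⟨r, rfl⟩
    exact neg_nonpos.2 (inv_nonneg.2 (hpos _ (zero_le_one.trans (le_max_left _ _))).le)
  have hlim := (tendsto_atTop_ciSup hg hbdd).congr' (f₂ := fun r => -(y r)⁻¹) (by
    filter_upwards [eventually_ge_atTop 1] with r hr
    rw [max_eq_right hr])
  -- The primitive $-1/y$ is bounded. On the exceptional set $1/r<y'/y^2$, so integrability here is
  -- the whole lemma.
  have hint : IntegrableOn (fun r => y' r / y r ^ 2) (Ioi 1) := by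
    refine integrableOn_Ioi_deriv_of_nonneg' (g := fun r => -(y r)⁻¹) (fun r hr => ?_)
      (fun r hr => div_nonneg (hy' r (zero_le_one.trans hr.le)) (sq_nonneg _)) hlim
    have := ((hy r).fun_inv (hpos r (zero_le_one.trans hr)).ne').fun_neg
    rwa [neg_div, neg_neg] at this
  calc ∫⁻ r in {r | 1 < r ∧ y r ^ 2 < r * y' r}, ENNReal.ofReal (1 / r)
      ≤ ∫⁻ r in {r | 1 < r ∧ y r ^ 2 < r * y' r}, ENNReal.ofReal (y' r / y r ^ 2) := by
        refine setLIntegral_mono' hmeas fun r hr => ENNReal.ofReal_le_ofReal ?_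
        have hr0 : (0 : ℝ) < r := one_pos.trans hr.1
        rw [div_le_div_iff₀ hr0 (pow_pos (hpos r hr0.le) 2)]
        linarith [hr.2]
    _ ≤ ∫⁻ r in Ioi 1, ENNReal.ofReal (y' r / y r ^ 2) :=
        lintegral_mono_set fun r hr => hr.1
    _ < ⊤ := hint.lintegral_lt_top

/-- Circle averages of a nonnegative function are bounded by a power of its logarithmic integral. -/
theorem exists_circleAverage_le_logIntegral {q : ℂ → ℝ} (hq : Continuous q) (h0 : ∀ z, 0 ≤ q z) :
    ∃ E, IsLogSmall E ∧ ∀ r, 1 < r → r ∉ E → circleAverage q 0 r ≤ (logIntegral q r + 2) ^ 6 := by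
  have hA := continuous_discIntegral hq
  have hAd := continuous_discIntegral_div hq
  have hav : Continuous fun r => r * (2 * π * circleAverage q 0 r) := by fun_prop
  have E1 := isLogSmall_growth (y := fun r => logIntegral q r + 2)
    (fun r => (hasDerivAt_logIntegral hq r).add_const 2)
    (fun r hr => div_nonneg (discIntegral_nonneg h0 hr) hr) hAd.measurable
    (fun r hr => by linarith [logIntegral_nonneg h0 hr])
  have E2 := isLogSmall_growth (y := fun r => discIntegral q r + 2)
    (fun r => (hasDerivAt_discIntegral hq r).add_const 2)
    (fun r hr => mul_nonneg hr (mul_nonneg (by positivity) (circleAverage_nonneg_of_nonneg' h0 r)))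
    hav.measurable (fun r hr => by linarith [discIntegral_nonneg h0 hr])
  refine ⟨_, E1.union E2, fun r hr hrE => ?_⟩
  simp only [mem_union, mem_ofPred_eq, not_or, not_and, not_lt] at hrE
  have hr0 : (0 : ℝ) < r := one_pos.trans hr
  have a1 := hrE.1 hr
  have a2 := hrE.2 hr
  rw [mul_div_cancel₀ _ hr0.ne'] at a1
  set Y := logIntegral q r + 2
  have hY : 2 ≤ Y := by simp only [Y]; linarith [logIntegral_nonneg h0 hr0.le]
  have hA0 := discIntegral_nonneg h0 hr0.le
  have hc0 := circleAverage_nonneg_of_nonneg' h0 r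
  -- The shift by $2$ gives $Y\ge 2$, so that $Y^2+2\le Y^3$. The second growth estimate then
  -- squares this cube, which produces the exponent $6$.
  have a3 : discIntegral q r + 2 ≤ Y ^ 3 := by nlinarith [sq_nonneg Y, mul_self_nonneg (Y - 2)]
  calc circleAverage q 0 r ≤ r * (r * (2 * π * circleAverage q 0 r)) := by
        have : 1 ≤ r * (r * (2 * π)) := by
          have : 1 ≤ r * (2 * π) := by nlinarith [pi_gt_three]
          nlinarith
        nlinarith
    _ ≤ (discIntegral q r + 2) ^ 2 := a2
    _ ≤ (Y ^ 3) ^ 2 := by gcongr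
    _ = Y ^ 6 := by ring

theorem continuous_log_one_add {q : ℂ → ℝ} (hq : Continuous q) (h0 : ∀ z, 0 ≤ q z) :
    Continuous fun z => log (1 + q z) :=
  Continuous.log (by fun_prop) fun z => by linarith [h0 z]

/-- Concavity of the logarithm, for circle averages. -/
theorem circleAverage_log_le {q : ℂ → ℝ} (hq : Continuous q) (h0 : ∀ z, 0 ≤ q z) (r : ℝ) :
    circleAverage (fun z => log (1 + q z)) 0 r ≤ log (1 + circleAverage q 0 r) := by
  set m := circleAverage q 0 r
  have hm : 0 ≤ m := circleAverage_nonneg_of_nonneg' h0 r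
  have hlog := continuous_log_one_add hq h0
  -- The graph of the logarithm lies below its tangent at $1+m$; averaging this affine bound is
  -- Jensen's inequality.
  have h : ∀ z, log (1 + q z) ≤ (log (1 + m) - m / (1 + m)) + (1 + m)⁻¹ * q z := by
    intro z
    have h1 : 0 < 1 + q z := by linarith [h0 z]
    have h2 : 0 < 1 + m := by linarith
    have := log_le_sub_one_of_pos (div_pos h1 h2)
    rw [log_div h1.ne' h2.ne'] at this
    have e : (1 + q z) / (1 + m) - 1 = (1 + m)⁻¹ * q z - m / (1 + m) := by field_simp; ring
    linarith
  refine (circleAverage_mono_of_continuous hlog (by fun_prop) h r).trans_eq ?_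
  rw [circleAverage_fun_add (circleIntegrable_of_continuous (by fun_prop) r)
    (circleIntegrable_of_continuous (by fun_prop) r), circleAverage_const]
  have := circleAverage_fun_smul (f := q) (c := 0) (R := r) (a := (1 + m)⁻¹)
  simp only [smul_eq_mul] at this
  rw [this]
  change log (1 + m) - m / (1 + m) + (1 + m)⁻¹ * m = _
  ring

/-- `s(r) ≤ C log (T(r) + C)` outside a set of finite logarithmic measure. -/
def SmallOutside (T s : ℝ → ℝ) : Prop :=
  ∃ E, IsLogSmall E ∧ ∃ C : ℝ, 3 ≤ C ∧ ∀ r, 1 < r → r ∉ E → s r ≤ C * log (T r + C)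

/-! ### Calculus of error terms that are logarithmic in $T$ off exceptional sets. -/

namespace SmallOutside

variable {T s s' : ℝ → ℝ}

theorem mono (h : SmallOutside T s) (hs : ∀ r, 1 < r → s' r ≤ s r) : SmallOutside T s' := by
  obtain ⟨E, hE, C, hC, h⟩ := h
  exact ⟨E, hE, C, hC, fun r hr hrE => (hs r hr).trans (h r hr hrE)⟩

/-- Since $e<3$. This is why constants in `SmallOutside` are at least $3$: the logarithm then
absorbs bounded terms even where $T$ is small. -/
theorem one_le_log {x C : ℝ} (hx : 0 ≤ x) (hC : 3 ≤ C) : 1 ≤ log (x + C) := by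
  rw [le_log_iff_exp_le (by linarith)]
  linarith [exp_one_lt_d9]

theorem const (hT : ∀ r, 1 < r → 0 ≤ T r) (c : ℝ) : SmallOutside T fun _ => c := by
  refine ⟨∅, IsLogSmall.empty, max 3 |c|, le_max_left _ _, fun r hr _ => ?_⟩
  have := one_le_log (hT r hr) (le_max_left 3 |c|)
  have h2 := le_max_right 3 |c|
  have h3 := le_abs_self c
  have h4 := abs_nonneg c
  nlinarith

theorem add (hT : ∀ r, 1 < r → 0 ≤ T r) (h : SmallOutside T s) (h' : SmallOutside T s') :
    SmallOutside T fun r => s r + s' r := by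
  obtain ⟨E, hE, C, hC, h⟩ := h
  obtain ⟨E', hE', C', hC', h'⟩ := h'
  refine ⟨_, hE.union hE', C + C', by linarith, fun r hr hrE => ?_⟩
  simp only [mem_union, not_or] at hrE
  have a := h r hr hrE.1
  have a' := h' r hr hrE.2
  have hT := hT r hr
  have l1 : log (T r + C) ≤ log (T r + (C + C')) := log_le_log (by linarith) (by linarith)
  have l2 : log (T r + C') ≤ log (T r + (C + C')) := log_le_log (by linarith) (by linarith)
  nlinarith

theorem const_mul (hT : ∀ r, 1 < r → 0 ≤ T r) (h : SmallOutside T s) {c : ℝ} (hc : 0 ≤ c) :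
    SmallOutside T fun r => c * s r := by
  obtain ⟨E, hE, C, hC, h⟩ := h
  refine ⟨E, hE, (1 + c) * C, by nlinarith, fun r hr hrE => ?_⟩
  have a := h r hr hrE
  have hT := hT r hr
  have l0 := one_le_log hT hC
  have l1 : log (T r + C) ≤ log (T r + (1 + c) * C) := log_le_log (by linarith) (by nlinarith)
  have l3 : 0 ≤ c * C := by positivity
  nlinarith [mul_le_mul_of_nonneg_left a hc, mul_le_mul_of_nonneg_left l1 l3]

/-- Smallness with respect to `T'` implies smallness with respect to `T` if `T'` is bounded by a
multiple of `T` up to a small error. -/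
theorem trans {T' : ℝ → ℝ} (hT : ∀ r, 1 < r → 0 ≤ T r) (hT' : ∀ r, 1 < r → 0 ≤ T' r)
    (h : SmallOutside T' s) {K : ℝ} (hK : 0 ≤ K)
    (h' : SmallOutside T fun r => T' r - K * T r) : SmallOutside T s := by
  obtain ⟨E, hE, C, hC, h⟩ := h
  obtain ⟨E', hE', C', hC', h'⟩ := h'
  refine ⟨_, hE.union hE', 2 * C * (C + C' + K), by nlinarith, fun r hr hrE => ?_⟩
  simp only [mem_union, not_or] at hrE
  have a := h r hr hrE.1
  have a' := h' r hr hrE.2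
  have hT := hT r hr
  have hT' := hT' r hr
  set D := C + C' + K
  have hD : 6 ≤ D := by simp only [D]; linarith
  have hCD : D ≤ 2 * C * D := by nlinarith
  have l0 := log_le_sub_one_of_pos (show 0 < T r + C' by linarith)
  -- A quadratic bound costs only a factor $2$ after taking logarithms. The factor $2C$ in the shift
  -- leaves room for the resulting multiplier of the logarithm.
  have b1 : T' r + C ≤ (T r + 2 * C * D) ^ 2 := by
    have b2 : T' r + C ≤ D * (T r + D) := by
      have : C' * log (T r + C') ≤ C' * (T r + C' - 1) := by gcongr
      have hKT : 0 ≤ K * C := by positivity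
      have : 0 ≤ C * T r := by positivity
      simp only [D]
      nlinarith [mul_nonneg hK hK, mul_nonneg hK (by linarith : (0:ℝ) ≤ C')]
    have b3 : D * (T r + D) ≤ (T r + D) * (T r + D) := by gcongr; linarith
    have b4 : (T r + D) * (T r + D) ≤ (T r + 2 * C * D) * (T r + 2 * C * D) := by gcongr
    linarith [sq (T r + 2 * C * D)]
  have b5 : log (T' r + C) ≤ 2 * log (T r + 2 * C * D) := by
    have := log_le_log (by linarith) b1
    rwa [log_pow, Nat.cast_ofNat] at this
  have b6 := one_le_log hT (show 3 ≤ 2 * C * D by linarith)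
  have : C * log (T' r + C) ≤ C * (2 * log (T r + 2 * C * D)) := by gcongr
  nlinarith [mul_nonneg (show 0 ≤ 2 * C by linarith) (show 0 ≤ D - 1 by linarith)]

/-- The proximity function of a continuous density is small with respect to its logarithmic
integral. -/
theorem circleAverage_log {q : ℂ → ℝ} (hq : Continuous q) (h0 : ∀ z, 0 ≤ q z) :
    SmallOutside (logIntegral q) fun r => circleAverage (fun z => log (1 + q z)) 0 r := by
  obtain ⟨E, hE, h⟩ := exists_circleAverage_le_logIntegral hq h0
  refine ⟨E, hE, 7, by norm_num, fun r hr hrE => ?_⟩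
  have h1 := h r hr hrE
  have h2 := circleAverage_log_le hq h0 r
  have h3 := logIntegral_nonneg h0 (zero_le_one.trans hr.le)
  have h4 := circleAverage_nonneg_of_nonneg' h0 r
  refine h2.trans ?_
  -- One extra power absorbs the summand $1$; the exponent $7$ is then the multiplier of the
  -- logarithm.
  have : 1 + circleAverage q 0 r ≤ (logIntegral q r + 7) ^ 7 := by
    have a1 : (logIntegral q r + 2) ^ 6 ≤ (logIntegral q r + 7) ^ 6 := by gcongr; norm_num
    have a2 : (1 : ℝ) ≤ (logIntegral q r + 7) ^ 6 := one_le_pow₀ (by linarith)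
    have a3 : (logIntegral q r + 7) ^ 7 = (logIntegral q r + 7) ^ 6 * (logIntegral q r + 7) := by ring
    nlinarith
  have := log_le_log (by linarith) this
  rwa [log_pow] at this

theorem circleAverage_add (hT : ∀ r, 1 < r → 0 ≤ T r) {p q : ℂ → ℝ} (hp : Continuous p)
    (hq : Continuous q) (h : SmallOutside T fun r => circleAverage p 0 r)
    (h' : SmallOutside T fun r => circleAverage q 0 r) :
    SmallOutside T fun r => circleAverage (fun z => p z + q z) 0 r :=
  (h.add hT h').mono fun r _ => (circleAverage_fun_add (circleIntegrable_of_continuous hp r)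
    (circleIntegrable_of_continuous hq r)).le

theorem circleAverage_mono {p q : ℂ → ℝ} (hp : Continuous p) (hq : Continuous q)
    (h : SmallOutside T fun r => circleAverage q 0 r) (hpq : ∀ z, p z ≤ q z) :
    SmallOutside T fun r => circleAverage p 0 r :=
  h.mono fun r _ => circleAverage_mono_of_continuous hp hq hpq r

/-- Once $T\ge C\ge 3$ one has $T+C\le T^2$, so the additive constant inside the logarithm
disappears at the price of a factor $2$. -/
theorem isBigOOutside (h : SmallOutside T s) (hs : ∀ r, 1 < r → 0 ≤ s r)
    (hT : Tendsto T atTop atTop) : FermatJet.IsBigOOutside s fun r => log (T r) := by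
  obtain ⟨E, hE, C, hC, h⟩ := h
  refine ⟨E, hE.1, hE.2.1, hE.2.2, ?_⟩
  refine Asymptotics.IsBigO.of_bound (2 * C) ?_
  rw [eventually_inf_principal]
  filter_upwards [eventually_gt_atTop 1, hT.eventually_ge_atTop C] with r hr hTr hrE
  have h1 := h r hr hrE
  have h2 : log (T r + C) ≤ 2 * log (T r) := by
    have := log_le_log (by linarith) (show T r + C ≤ T r ^ 2 by nlinarith)
    rwa [log_pow, Nat.cast_ofNat] at this
  rw [norm_of_nonneg (hs r hr)]
  have h3 : log (T r) ≤ ‖log (T r)‖ := le_norm_self _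
  nlinarith [mul_le_mul_of_nonneg_left (h2.trans (mul_le_mul_of_nonneg_left h3 zero_le_two))
    (show 0 ≤ C by linarith)]

end SmallOutside

/-- Logarithmic integrals of nonnegative functions that do not vanish identically are unbounded. -/
theorem tendsto_logIntegral_atTop {q : ℂ → ℝ} (hq : Continuous q) (h0 : ∀ z, 0 ≤ q z) {a : ℂ}
    (ha : q a ≠ 0) : Tendsto (logIntegral q) atTop atTop := by
  set R := ‖a‖ + 1
  have hR : 0 < R := by positivity
  have hA : 0 < discIntegral q R := by
    rw [discIntegral, ← setIntegral_ball_eq_circleAverage hq hR.le]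
    refine (setIntegral_pos_iff_support_of_nonneg_ae (Eventually.of_forall h0)
      ((hq.continuousOn.integrableOn_compact (isCompact_closedBall 0 R)).mono_set
        Metric.ball_subset_closedBall)).2 ?_
    refine IsOpen.measure_pos _ (hq.isOpen_support.inter Metric.isOpen_ball) ⟨a, ha, ?_⟩
    simp [R]
  have hmono : ∀ r, R ≤ r → discIntegral q R ≤ discIntegral q r := by
    intro r hr
    have : MonotoneOn (discIntegral q) (Ici 0) := by
      refine monotoneOn_of_deriv_nonneg (convex_Ici 0) (continuous_discIntegral hq).continuousOn
        (fun r _ => (hasDerivAt_discIntegral hq r).differentiableAt.differentiableWithinAt)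
        fun r hr => ?_
      rw [(hasDerivAt_discIntegral hq r).deriv]
      exact mul_nonneg (interior_subset hr)
        (mul_nonneg (by positivity) (circleAverage_nonneg_of_nonneg' h0 r))
    exact this hR.le (hR.le.trans hr) hr
  -- The disc integral is at least its positive value at $R$ from there on, and integrating it
  -- against $d\rho/\rho$ gives logarithmic growth.
  have hlow : ∀ r, R ≤ r → discIntegral q R * (log r - log R) ≤ logIntegral q r := by
    intro r hr
    have hM : MonotoneOn (fun r => logIntegral q r - discIntegral q R * log r) (Ici R) := by
      have hder : ∀ r, R ≤ r → HasDerivAt (fun r => logIntegral q r - discIntegral q R * log r)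
          (discIntegral q r / r - discIntegral q R * r⁻¹) r := fun r hr =>
        (hasDerivAt_logIntegral hq r).sub ((hasDerivAt_log (hR.trans_le hr).ne').const_mul _)
      refine monotoneOn_of_deriv_nonneg (convex_Ici R)
        (fun r hr => (hder r hr).continuousAt.continuousWithinAt)
        (fun r hr => (hder r (interior_subset hr)).differentiableAt.differentiableWithinAt)
        fun r hr => ?_
      have hr' : R ≤ r := interior_subset hr
      rw [(hder r hr').deriv, ← div_eq_mul_inv, ← sub_div]
      exact div_nonneg (sub_nonneg.2 (hmono r hr')) (hR.le.trans hr')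
    have := hM self_mem_Ici hr hr
    simp only at this
    have := logIntegral_nonneg h0 hR.le
    linarith
  refine tendsto_atTop_mono' _ (eventually_atTop.2 ⟨R, hlow⟩) ?_
  exact (tendsto_atTop_add_const_right _ _ tendsto_log_atTop).const_mul_atTop hA

/-! ### The Fubini–Study density of a holomorphic tuple -/

section FubiniStudy

variable {ι : Type*} [Fintype ι]

/-- The square of the Hermitian norm of a tuple of functions. -/
noncomputable def normSqSum (G : ι → ℂ → ℂ) (z : ℂ) : ℝ := ∑ i, ‖G i z‖ ^ 2

/-- The Hermitian product of a tuple with its derivative. -/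
noncomputable def derivPairing (G : ι → ℂ → ℂ) (z : ℂ) : ℂ :=
  ∑ i, (starRingEnd ℂ) (G i z) * deriv (G i) z

/-- The density `|G ∧ G'|² / |G|⁴` of the pull-back of (`π` times) the Fubini–Study form under the
curve with homogeneous coordinates `G`. -/
noncomputable def fsDensity (G : ι → ℂ → ℂ) (z : ℂ) : ℝ :=
  (normSqSum G z * normSqSum (fun i => deriv (G i)) z - ‖derivPairing G z‖ ^ 2) / normSqSum G z ^ 2

theorem normSqSum_nonneg (G : ι → ℂ → ℂ) (z : ℂ) : 0 ≤ normSqSum G z :=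
  Finset.sum_nonneg fun _ _ => sq_nonneg _

theorem sq_norm_le_normSqSum (G : ι → ℂ → ℂ) (z : ℂ) (i : ι) : ‖G i z‖ ^ 2 ≤ normSqSum G z :=
  Finset.single_le_sum (f := fun i => ‖G i z‖ ^ 2) (fun _ _ => sq_nonneg _) (Finset.mem_univ i)

theorem normSqSum_pos {G : ι → ℂ → ℂ} {z : ℂ} {i : ι} (h : G i z ≠ 0) : 0 < normSqSum G z :=
  lt_of_lt_of_le (by positivity) (sq_norm_le_normSqSum G z i)

/-- **Lagrange's identity** for two vectors in a complex coordinate space. -/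
theorem sum_sq_norm_mul_sub (a b : ι → ℂ) :
    ∑ i, ∑ j, ‖a i * b j - a j * b i‖ ^ 2
      = 2 * ((∑ i, ‖a i‖ ^ 2) * (∑ i, ‖b i‖ ^ 2) - ‖∑ i, (starRingEnd ℂ) (a i) * b i‖ ^ 2) := by
  have hn : ∀ w : ℂ, ((‖w‖ ^ 2 : ℝ) : ℂ) = (starRingEnd ℂ) w * w := fun w => by
    rw [Complex.conj_mul']; push_cast; rfl
  apply Complex.ofReal_injective
  push_cast
  simp only [← Complex.ofReal_pow, hn, map_sub, map_mul, map_sum, Complex.conj_conj]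
  have e : ∀ i j, ((starRingEnd ℂ) (a i) * (starRingEnd ℂ) (b j)
        - (starRingEnd ℂ) (a j) * (starRingEnd ℂ) (b i)) * (a i * b j - a j * b i)
      = ((starRingEnd ℂ) (a i) * a i) * ((starRingEnd ℂ) (b j) * b j)
        + ((starRingEnd ℂ) (b i) * b i) * ((starRingEnd ℂ) (a j) * a j)
        - ((starRingEnd ℂ) (a i) * b i) * (a j * (starRingEnd ℂ) (b j))
        - (a i * (starRingEnd ℂ) (b i)) * ((starRingEnd ℂ) (a j) * b j) := fun i j => by ring
  simp only [e, Finset.sum_sub_distrib, Finset.sum_add_distrib, ← Finset.sum_mul_sum]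
  ring

theorem sum_sq_norm_wronskian (G : ι → ℂ → ℂ) (z : ℂ) :
    ∑ i, ∑ j, ‖G i z * deriv (G j) z - G j z * deriv (G i) z‖ ^ 2
      = 2 * (normSqSum G z * normSqSum (fun i => deriv (G i)) z - ‖derivPairing G z‖ ^ 2) :=
  sum_sq_norm_mul_sub _ _

/-- A single minor is bounded by the norm of `G ∧ G'`. -/
theorem sq_norm_wronskian_le (G : ι → ℂ → ℂ) (z : ℂ) (i j : ι) :
    ‖G i z * deriv (G j) z - G j z * deriv (G i) z‖ ^ 2
      ≤ normSqSum G z * normSqSum (fun i => deriv (G i)) z - ‖derivPairing G z‖ ^ 2 := by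
  classical
  rcases eq_or_ne i j with rfl | hij
  · rw [sub_self, norm_zero, zero_pow two_ne_zero]
    have := sum_sq_norm_wronskian G z
    have : 0 ≤ ∑ i, ∑ j, ‖G i z * deriv (G j) z - G j z * deriv (G i) z‖ ^ 2 :=
      Finset.sum_nonneg fun _ _ => Finset.sum_nonneg fun _ _ => sq_nonneg _
    linarith
  · have h := sum_sq_norm_wronskian G z
    set W : ι → ι → ℝ := fun i j => ‖G i z * deriv (G j) z - G j z * deriv (G i) z‖ ^ 2 with hW
    have hrow : ∀ i j, W i j ≤ ∑ j, W i j := fun i j =>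
      Finset.single_le_sum (f := fun j => W i j) (fun _ _ => sq_nonneg _) (Finset.mem_univ j)
    -- Each minor is counted for both orders of its indices, which compensates the factor $2$ in
    -- Lagrange's identity.
    have hpair : (∑ k ∈ ({i, j} : Finset ι), ∑ l, W k l) ≤ ∑ k, ∑ l, W k l :=
      Finset.sum_le_sum_of_subset_of_nonneg (Finset.subset_univ _)
        fun _ _ _ => Finset.sum_nonneg fun _ _ => sq_nonneg _
    rw [Finset.sum_pair hij] at hpair
    have hsymm : W j i = W i j := by simp only [hW]; rw [norm_sub_rev]
    have h1 := hrow i j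
    have h2 := hrow j i
    change W i j ≤ _
    linarith

theorem fsDensity_nonneg (G : ι → ℂ → ℂ) (z : ℂ) : 0 ≤ fsDensity G z := by
  refine div_nonneg ?_ (sq_nonneg _)
  have h := sum_sq_norm_wronskian G z
  have : 0 ≤ ∑ i, ∑ j, ‖G i z * deriv (G j) z - G j z * deriv (G i) z‖ ^ 2 :=
    Finset.sum_nonneg fun _ _ => Finset.sum_nonneg fun _ _ => sq_nonneg _
  linarith

theorem sq_norm_wronskian_le_fsDensity {G : ι → ℂ → ℂ} {z : ℂ} (h : 0 < normSqSum G z) (i j : ι) :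
    ‖G i z * deriv (G j) z - G j z * deriv (G i) z‖ ^ 2 ≤ fsDensity G z * normSqSum G z ^ 2 := by
  rw [fsDensity, div_mul_cancel₀ _ (pow_pos h 2).ne']
  exact sq_norm_wronskian_le G z i j

theorem fsDensity_eq_sum (G : ι → ℂ → ℂ) (z : ℂ) :
    fsDensity G z = (∑ i, ∑ j, ‖G i z * deriv (G j) z - G j z * deriv (G i) z‖ ^ 2)
      / (2 * normSqSum G z ^ 2) := by
  rw [sum_sq_norm_wronskian, fsDensity, mul_div_mul_left _ _ two_ne_zero]

/-- The Fubini–Study density does not depend on the choice of homogeneous coordinates. -/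
theorem fsDensity_mul {G : ι → ℂ → ℂ} {lam : ℂ → ℂ} {z : ℂ}
    (hG : ∀ i, DifferentiableAt ℂ (G i) z) (hl : DifferentiableAt ℂ lam z) (h0 : lam z ≠ 0) :
    fsDensity (fun i w => lam w * G i w) z = fsDensity G z := by
  have hn : 0 < ‖lam z‖ := norm_pos_iff.2 h0
  have e1 : normSqSum (fun i w => lam w * G i w) z = ‖lam z‖ ^ 2 * normSqSum G z := by
    simp [normSqSum, Finset.mul_sum, mul_pow]
  have e2 : ∀ i j, lam z * G i z * deriv (fun w => lam w * G j w) z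
      - lam z * G j z * deriv (fun w => lam w * G i w) z
      = lam z ^ 2 * (G i z * deriv (G j) z - G j z * deriv (G i) z) := by
    intro i j
    rw [deriv_fun_mul hl (hG i), deriv_fun_mul hl (hG j)]
    ring
  rw [fsDensity_eq_sum, fsDensity_eq_sum, e1]
  simp only [e2, norm_mul, norm_pow, mul_pow, ← Finset.mul_sum]
  have : ‖lam z‖ ≠ 0 := hn.ne'
  rw [show 2 * ((‖lam z‖ ^ 2) ^ 2 * normSqSum G z ^ 2)
    = (‖lam z‖ ^ 2) ^ 2 * (2 * normSqSum G z ^ 2) by ring]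
  exact mul_div_mul_left _ _ (by positivity)

theorem fsDensity_congr {G H : ι → ℂ → ℂ} {z : ℂ} (h : ∀ i, G i =ᶠ[𝓝 z] H i) :
    fsDensity G z = fsDensity H z := by
  have e : ∀ i, G i z = H i z := fun i => (h i).eq_of_nhds
  have e' : ∀ i, deriv (G i) z = deriv (H i) z := fun i => (h i).deriv_eq
  simp only [fsDensity, normSqSum, derivPairing, e, e']

/-! ### Laplacians -/

theorem contDiffAt_real {g : ℂ → ℂ} {z : ℂ} (hg : AnalyticAt ℂ g z) {n : ℕ∞} :
    ContDiffAt ℝ n g z :=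
  hg.contDiffAt.restrict_scalars ℝ

theorem contDiffAt_normSqSum {G : ι → ℂ → ℂ} {z : ℂ} (hG : ∀ i, AnalyticAt ℂ (G i) z) {n : ℕ∞} :
    ContDiffAt ℝ n (normSqSum G) z :=
  ContDiffAt.sum fun i _ => (contDiffAt_real (hG i)).norm_sq ℝ

theorem contDiffAt_fsDensity {G : ι → ℂ → ℂ} {z : ℂ} (hG : ∀ i, AnalyticAt ℂ (G i) z)
    (h0 : normSqSum G z ≠ 0) {n : ℕ∞} : ContDiffAt ℝ n (fsDensity G) z := by
  have hp : ContDiffAt ℝ n (derivPairing G) z := ContDiffAt.sum fun i _ =>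
    (Complex.conjCLE.contDiff.contDiffAt.comp z (contDiffAt_real (hG i))).mul
      (contDiffAt_real (hG i).deriv)
  exact (((contDiffAt_normSqSum hG).mul (contDiffAt_normSqSum fun i => (hG i).deriv)).sub
    (hp.norm_sq ℝ)).div ((contDiffAt_normSqSum hG).pow 2) (pow_ne_zero 2 h0)

theorem fderiv_fderiv_apply {φ : ℂ → ℝ} {z : ℂ} (h : ContDiffAt ℝ 2 φ z) (v : ℂ) :
    fderiv ℝ (fderiv ℝ φ) z v v = fderiv ℝ (fun w => fderiv ℝ φ w v) z v := by
  have hd : DifferentiableAt ℝ (fderiv ℝ φ) z :=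
    (h.fderiv_right (m := 1) (by norm_num)).differentiableAt (by norm_num)
  rw [fderiv_clm_apply hd (differentiableAt_const v)]
  simp

theorem laplacian_log {U : ℂ → ℝ} {z : ℂ} (hU : ContDiffAt ℝ 2 U z) (h0 : U z ≠ 0) :
    Δ (fun w => log (U w)) z = Δ U z / U z
      - ((fderiv ℝ U z 1) ^ 2 + (fderiv ℝ U z Complex.I) ^ 2) / U z ^ 2 := by
  have hd : DifferentiableAt ℝ U z := hU.differentiableAt (by norm_num)
  have hd1 : DifferentiableAt ℝ (fderiv ℝ U) z :=
    (hU.fderiv_right (m := 1) (by norm_num)).differentiableAt (by norm_num)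
  have hev : fderiv ℝ (fun w => log (U w)) =ᶠ[𝓝 z] fun w => (U w)⁻¹ • fderiv ℝ U w := by
    have h1 := hU.eventually (by norm_num)
    have h2 := hU.continuousAt.eventually_ne h0
    filter_upwards [h1, h2] with w hw1 hw2
    exact ((hw1.differentiableAt (by norm_num)).hasFDerivAt.log hw2).fderiv
  have hF : HasFDerivAt (fun w => (U w)⁻¹ • fderiv ℝ U w) _ z :=
    ((hasDerivAt_inv h0).comp_hasFDerivAt z hd.hasFDerivAt).fun_smul hd1.hasFDerivAt
  rw [laplacian_apply, laplacian_apply, hev.fderiv_eq, hF.fderiv]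
  simp
  field_simp
  ring

theorem fderiv_normSqSum {G : ι → ℂ → ℂ} {z : ℂ} (hG : ∀ i, DifferentiableAt ℂ (G i) z) (v : ℂ) :
    fderiv ℝ (normSqSum G) z v = 2 * (derivPairing G z * v).re := by
  have h : HasFDerivAt (normSqSum G) _ z := HasFDerivAt.fun_sum fun i (_ : i ∈ Finset.univ) =>
    ((hG i).hasDerivAt.hasFDerivAt.restrictScalars ℝ).norm_sq
  rw [h.fderiv]
  simp only [derivPairing, Finset.sum_mul, Complex.re_sum, Finset.mul_sum, sum_apply]
  refine Finset.sum_congr rfl fun i _ => ?_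
  simp [Complex.inner]
  ring

/-- The two real partial derivatives are twice the real part and minus twice the imaginary part of
the pairing. -/
theorem fderiv_normSqSum_sq {G : ι → ℂ → ℂ} {z : ℂ} (hG : ∀ i, DifferentiableAt ℂ (G i) z) :
    (fderiv ℝ (normSqSum G) z 1) ^ 2 + (fderiv ℝ (normSqSum G) z Complex.I) ^ 2
      = 4 * ‖derivPairing G z‖ ^ 2 := by
  rw [fderiv_normSqSum hG, fderiv_normSqSum hG, Complex.sq_norm, Complex.normSq_apply]
  simp
  ring

theorem laplacian_normSqSum {G : ι → ℂ → ℂ} {z : ℂ} (hG : ∀ i, AnalyticAt ℂ (G i) z) :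
    Δ (normSqSum G) z = 4 * normSqSum (fun i => deriv (G i)) z := by
  have hev : ∀ v : ℂ, (fun w => fderiv ℝ (normSqSum G) w v)
      =ᶠ[𝓝 z] fun w => 2 * (derivPairing G w * v).re := by
    intro v
    have : ∀ᶠ w in 𝓝 z, ∀ i, AnalyticAt ℂ (G i) w :=
      eventually_all.2 fun i => (hG i).eventually_analyticAt
    filter_upwards [this] with w hw
    exact fderiv_normSqSum (fun i => (hw i).differentiableAt) v
  have hp : HasFDerivAt (derivPairing G) _ z := HasFDerivAt.fun_sum fun i (_ : i ∈ Finset.univ) =>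
    (((hG i).differentiableAt.hasDerivAt.hasFDerivAt.restrictScalars ℝ).star).mul
      ((hG i).deriv.differentiableAt.hasDerivAt.hasFDerivAt.restrictScalars ℝ)
  have h : ∀ v : ℂ, HasFDerivAt (fun w => 2 * (derivPairing G w * v).re) _ z := fun v =>
    (Complex.reCLM.hasFDerivAt.comp z (hp.mul_const v)).const_mul 2
  have hC := contDiffAt_normSqSum hG (n := 2)
  rw [laplacian_apply, fderiv_fderiv_apply hC, fderiv_fderiv_apply hC, (hev _).fderiv_eq,
    (hev _).fderiv_eq, (h 1).fderiv, (h Complex.I).fderiv]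
  simp [normSqSum, Finset.mul_sum, ← Finset.sum_add_distrib]
  refine Finset.sum_congr rfl fun i _ => ?_
  rw [Complex.sq_norm, Complex.normSq_apply]
  ring

/-- The Fubini–Study form is the curvature form of `log |G|²`. -/
theorem laplacian_log_normSqSum {G : ι → ℂ → ℂ} {z : ℂ} (hG : ∀ i, AnalyticAt ℂ (G i) z)
    (h0 : normSqSum G z ≠ 0) : Δ (fun w => log (normSqSum G w)) z = 4 * fsDensity G z := by
  rw [laplacian_log (contDiffAt_normSqSum hG) h0, laplacian_normSqSum hG,
    fderiv_normSqSum_sq fun i => (hG i).differentiableAt, fsDensity]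
  field_simp

end FubiniStudy

/-! ### Characteristic functions -/

section Characteristic

variable {ι : Type*}

/-- The homogeneous coordinates `[1, F 1, …, F m]`. -/
def withOne (F : ι → ℂ → ℂ) : Option ι → ℂ → ℂ := fun o => o.elim (fun _ => 1) F

theorem analyticAt_withOne {F : ι → ℂ → ℂ} {z : ℂ} (h : ∀ i, AnalyticAt ℂ (F i) z) (o : Option ι) :
    AnalyticAt ℂ (withOne F o) z := by
  cases o with
  | none => exact analyticAt_const
  | some i => exact h i

variable [Fintype ι]

theorem normSqSum_withOne (F : ι → ℂ → ℂ) (z : ℂ) :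
    normSqSum (withOne F) z = 1 + normSqSum F z := by
  simp [normSqSum, withOne, Fintype.sum_option]

theorem normSqSum_deriv_withOne (F : ι → ℂ → ℂ) (z : ℂ) :
    normSqSum (fun i => deriv (withOne F i)) z = normSqSum (fun i => deriv (F i)) z := by
  simp [normSqSum, withOne, Fintype.sum_option]

theorem normSqSum_withOne_pos (F : ι → ℂ → ℂ) (z : ℂ) : 0 < normSqSum (withOne F) z := by
  rw [normSqSum_withOne]
  linarith [normSqSum_nonneg F z]

theorem pi_mul_fubiniStudyDensity (F : ι → ℂ → ℂ) (z : ℂ) :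
    π * FermatJet.fubiniStudyDensity F z = fsDensity (withOne F) z := by
  have h1 := normSqSum_withOne F z
  have h2 := normSqSum_deriv_withOne F z
  have h3 : derivPairing (withOne F) z = ∑ i, (starRingEnd ℂ) (F i z) * deriv (F i) z := by
    simp [derivPairing, withOne, Fintype.sum_option]
  rw [fsDensity, h1, h2, h3, FermatJet.fubiniStudyDensity]
  simp only [normSqSum]
  field_simp

/-- Complements of codiscrete sets are null sets. The density may thus be replaced by its continuous
extension over the poles, to which the calculus of `logIntegral` applies. -/
theorem charT_eq_logIntegral {F : ι → ℂ → ℂ} {q : ℂ → ℝ} (hq : Continuous q)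
    (h : ∀ᶠ z in codiscrete ℂ, fsDensity (withOne F) z = q z) {r : ℝ} (hr : 0 ≤ r) :
    FermatJet.charT F r = π⁻¹ * logIntegral q r := by
  have hae : ∀ᵐ z : ℂ, FermatJet.fubiniStudyDensity F z = π⁻¹ * q z := by
    have h' : ∀ᶠ z in ae (volume.restrict (univ : Set ℂ)), fsDensity (withOne F) z = q z :=
      ae_restrict_le_codiscreteWithin MeasurableSet.univ h
    rw [Measure.restrict_univ] at h'
    filter_upwards [h'] with z hz
    rw [← hz, ← pi_mul_fubiniStudyDensity, ← mul_assoc, inv_mul_cancel₀ pi_ne_zero, one_mul]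
  have hi : ∀ ρ : ℝ, (∫ z in Metric.ball (0 : ℂ) ρ, FermatJet.fubiniStudyDensity F z)
      = π⁻¹ * ∫ z in Metric.ball (0 : ℂ) ρ, q z := by
    intro ρ
    rw [← integral_const_mul]
    exact integral_congr_ae (ae_restrict_of_ae hae)
  rw [logIntegral_eq hq hr, FermatJet.charT]
  simp only [hi, mul_div_assoc]
  exact intervalIntegral.integral_const_mul _ _

theorem charT_nonneg (F : ι → ℂ → ℂ) {r : ℝ} (hr : 0 ≤ r) : 0 ≤ FermatJet.charT F r := by
  refine intervalIntegral.integral_nonneg hr fun ρ hρ => div_nonneg ?_ hρ.1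
  refine integral_nonneg fun z => ?_
  have h := pi_mul_fubiniStudyDensity F z
  have h0 := fsDensity_nonneg (withOne F) z
  rw [← h] at h0
  exact nonneg_of_mul_nonneg_right h0 pi_pos

/-! ### Entire curves -/

variable {F : ι → ℂ → ℂ}

theorem contDiff_log_normSqSum_withOne (hF : ∀ i z, AnalyticAt ℂ (F i) z) :
    ContDiff ℝ 2 fun z => log (normSqSum (withOne F) z) :=
  contDiff_iff_contDiffAt.2 fun z =>
    (contDiffAt_normSqSum fun o => analyticAt_withOne (fun i => hF i z) o).log
      (normSqSum_withOne_pos F z).ne'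

theorem continuous_normSqSum {G : ι → ℂ → ℂ} (hG : ∀ i z, AnalyticAt ℂ (G i) z) :
    Continuous (normSqSum G) :=
  continuous_finsetSum _ fun i _ =>
    ((continuous_iff_continuousAt.2 fun z => (hG i z).continuousAt).norm.pow 2)

theorem logIntegral_laplacian_log_normSqSum (hF : ∀ i z, AnalyticAt ℂ (F i) z) {r : ℝ}
    (hr : 0 ≤ r) : logIntegral (Δ fun z => log (normSqSum (withOne F) z)) r
      = 4 * π * FermatJet.charT F r := by
  have hC := contDiff_log_normSqSum_withOne hF
  have hΔ : ∀ z, Δ (fun z => log (normSqSum (withOne F) z)) z = 4 * fsDensity (withOne F) z :=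
    fun z => laplacian_log_normSqSum (fun o => analyticAt_withOne (fun i => hF i z) o)
      (normSqSum_withOne_pos F z).ne'
  have hc : Continuous (fsDensity (withOne F)) := by
    have : fsDensity (withOne F)
        = fun z => (1 / 4) * Δ (fun z => log (normSqSum (withOne F) z)) z :=
      funext fun z => by rw [hΔ]; ring
    rw [this]
    exact continuous_const.mul (continuous_laplacian hC)
  rw [charT_eq_logIntegral hc (Eventually.of_forall fun _ => rfl) hr, funext hΔ,
    logIntegral_const_mul]
  field_simp

/-- The characteristic function of an entire curve is a circle average. -/
theorem charT_eq_circleAverage (hF : ∀ i z, AnalyticAt ℂ (F i) z) {r : ℝ} (hr : 0 ≤ r) :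
    FermatJet.charT F r = (circleAverage (fun z => log (normSqSum (withOne F) z)) 0 r
      - log (normSqSum (withOne F) 0)) / 2 := by
  have h1 := logIntegral_laplacian_log_normSqSum hF hr
  have h2 := logIntegral_laplacian (contDiff_log_normSqSum_withOne hF) hr
  rw [h1] at h2
  have : π ≠ 0 := pi_ne_zero
  field_simp
  have h3 : π * (2 * FermatJet.charT F r) = π * (circleAverage (fun z =>
    log (normSqSum (withOne F) z)) 0 r - log (normSqSum (withOne F) 0)) := by linarith
  linarith [mul_left_cancel₀ this h3]

/-- Meant for the average of $\log(1+\log(1+|F|^2))$: by concavity and Jensen's formula it is at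
most a logarithm of this form. -/
theorem SmallOutside.log_linear {T : ℝ → ℝ} (hT : ∀ r, 1 < r → 0 ≤ T r) {c : ℝ} (hc : 1 ≤ c) :
    SmallOutside T fun r => log (2 * T r + c) := by
  refine ⟨∅, IsLogSmall.empty, c + 2, by linarith, fun r hr _ => ?_⟩
  have h := hT r hr
  have h1 : log (2 * T r + c) ≤ log ((T r + (c + 2)) ^ 2) :=
    log_le_log (by linarith) (by nlinarith)
  rw [log_pow, Nat.cast_ofNat] at h1
  have h2 := SmallOutside.one_le_log h (show 3 ≤ c + 2 by linarith)
  nlinarith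

/-- The logarithmic derivative `|F'|² / (1 + |F|²)` of an entire curve has small proximity
function. -/
theorem SmallOutside.log_deriv (hF : ∀ i z, AnalyticAt ℂ (F i) z) :
    SmallOutside (FermatJet.charT F) fun r => circleAverage (fun z =>
      log (1 + normSqSum (fun i => deriv (F i)) z / normSqSum (withOne F) z)) 0 r := by
  set N := normSqSum (withOne F) with hN
  set u : ℂ → ℝ := fun z => log (N z) with hu
  have hT : ∀ r, 1 < r → 0 ≤ FermatJet.charT F r := fun r hr => charT_nonneg F (by linarith)
  have hF1 : ∀ z o, AnalyticAt ℂ (withOne F o) z := fun z o =>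
    analyticAt_withOne (fun i => hF i z) o
  have hNpos : ∀ z, 0 < N z := normSqSum_withOne_pos F
  have hN1 : ∀ z, 1 ≤ N z := fun z => by
    rw [hN, normSqSum_withOne]; linarith [normSqSum_nonneg F z]
  have hu0 : ∀ z, 0 ≤ u z := fun z => log_nonneg (hN1 z)
  have huC : ContDiff ℝ 2 u := contDiff_log_normSqSum_withOne hF
  have hψC : ContDiff ℝ 2 fun z => log (1 + u z) := contDiff_iff_contDiffAt.2 fun z =>
    (contDiff_const.add huC).contDiffAt.log (by linarith [hu0 z])
  have huc := huC.continuous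
  have hNc : Continuous N := continuous_normSqSum fun o z => hF1 z o
  have hfc : Continuous (fderiv ℝ u) := huC.continuous_fderiv (by norm_num)
  -- The gradient term of $\Delta\log(1+u)$. The denominator $(1+u)^2$ makes its logarithmic
  -- integral accessible to Jensen's formula and is itself harmless, since $\log(1+u)$ has small
  -- average.
  set q : ℂ → ℝ := fun z => ((fderiv ℝ u z 1) ^ 2 + (fderiv ℝ u z Complex.I) ^ 2) / (1 + u z) ^ 2
    with hq
  have hqc : Continuous q := by
    refine Continuous.div (by fun_prop) (by fun_prop) fun z => ?_
    have := hu0 z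
    positivity
  have hq0 : ∀ z, 0 ≤ q z := fun z => by positivity
  have hΔ : ∀ z, Δ u z = 4 * fsDensity (withOne F) z := fun z =>
    laplacian_log_normSqSum (hF1 z) (hNpos z).ne'
  have hΔ0 : ∀ z, 0 ≤ Δ u z := fun z => by
    rw [hΔ]; linarith [fsDensity_nonneg (withOne F) z]
  have hΔc : Continuous (Δ u) := continuous_laplacian huC
  have hψ : ∀ z, Δ (fun z => log (1 + u z)) z = Δ u z / (1 + u z) - q z := by
    intro z
    have h1 : Δ (fun z => 1 + u z) z = Δ u z := by
      have : fderiv ℝ (fun z => 1 + u z) = fderiv ℝ u := funext fun w => fderiv_const_add 1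
      rw [laplacian_apply, laplacian_apply, this]
    rw [laplacian_log (contDiff_const.add huC).contDiffAt (by linarith [hu0 z]), h1,
      fderiv_const_add]
  -- From $q+\Delta\log(1+u)=\Delta u/(1+u)\le\Delta u$; the circle average of $\log(1+u)\ge 0$
  -- enters with a favourable sign.
  have hJ : ∀ r, 1 < r → logIntegral q r - 4 * π * FermatJet.charT F r ≤ 2 * π * log (1 + u 0) := by
    intro r hr
    have hr0 : 0 ≤ r := by linarith
    have hψc := continuous_laplacian hψC
    have h1 := logIntegral_mono (hqc.fun_add hψc) hΔc (fun z => by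
      rw [hψ]
      have : Δ u z / (1 + u z) ≤ Δ u z := div_le_self (hΔ0 z) (by linarith [hu0 z])
      linarith) hr0
    rw [logIntegral_add hqc hψc, logIntegral_laplacian_log_normSqSum hF hr0,
      logIntegral_laplacian hψC hr0] at h1
    have h2 : 0 ≤ circleAverage (fun z => log (1 + u z)) 0 r :=
      circleAverage_nonneg_of_nonneg' (fun z => log_nonneg (by linarith [hu0 z])) r
    nlinarith [pi_pos, mul_nonneg pi_pos.le h2]
  have s1 : SmallOutside (FermatJet.charT F) fun r => circleAverage (fun z => log (1 + Δ u z)) 0 r :=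
    (SmallOutside.circleAverage_log hΔc hΔ0).trans hT
      (fun r hr => logIntegral_nonneg hΔ0 (by linarith)) (by positivity : 0 ≤ 4 * π)
      ((SmallOutside.const hT 0).mono fun r hr => by
        rw [logIntegral_laplacian_log_normSqSum hF (by linarith)]; linarith)
  have s2 : SmallOutside (FermatJet.charT F) fun r => circleAverage (fun z => log (1 + q z)) 0 r :=
    (SmallOutside.circleAverage_log hqc hq0).trans hT
      (fun r hr => logIntegral_nonneg hq0 (by linarith)) (by positivity : 0 ≤ 4 * π)
      ((SmallOutside.const hT _).mono hJ)
  have s3 : SmallOutside (FermatJet.charT F) fun r => circleAverage (fun z => log (1 + u z)) 0 r :=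
    (SmallOutside.log_linear hT (show 1 ≤ 1 + u 0 by linarith [hu0 0])).mono fun r hr => by
      refine (circleAverage_log_le huc hu0 r).trans_eq ?_
      rw [charT_eq_circleAverage hF (by linarith)]
      congr 1
      ring
  have c1 := continuous_log_one_add hΔc hΔ0
  have c2 := continuous_log_one_add hqc hq0
  have c3 := continuous_log_one_add huc hu0
  have hd0 : ∀ z, 0 ≤ normSqSum (fun i => deriv (F i)) z / N z := fun z =>
    div_nonneg (normSqSum_nonneg _ z) (hNpos z).le
  have c4 : Continuous fun z => log (1 + normSqSum (fun i => deriv (F i)) z / N z) :=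
    continuous_log_one_add ((continuous_normSqSum fun i z => (hF i z).deriv).div hNc
    fun z => (hNpos z).ne') hd0
  refine SmallOutside.circleAverage_mono c4 (by fun_prop)
    ((s1.circleAverage_add hT c1 c2 s2).circleAverage_add hT (by fun_prop) (by fun_prop)
      (s3.circleAverage_add hT c3 c3 s3)) fun z => ?_
  have p1 : 0 < 1 + Δ u z := by linarith [hΔ0 z]
  have p2 : 0 < 1 + q z := by linarith [hq0 z]
  have p3 : 0 < 1 + u z := by linarith [hu0 z]
  have hgrad : (fderiv ℝ u z 1) ^ 2 + (fderiv ℝ u z Complex.I) ^ 2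
      = 4 * ‖derivPairing (withOne F) z‖ ^ 2 / N z ^ 2 := by
    have : HasFDerivAt u ((N z)⁻¹ • fderiv ℝ N z) z :=
      ((contDiffAt_normSqSum (hF1 z) (n := 1)).differentiableAt
        (by norm_num)).hasFDerivAt.log (hNpos z).ne'
    rw [this.fderiv, ← fderiv_normSqSum_sq fun o => (hF1 z o).differentiableAt]
    simp only [smul_apply, smul_eq_mul]
    have := (hNpos z).ne'
    field_simp
    rfl
  -- This is $4|F'|^2/N=\Delta u+|\nabla u|^2$: the term in $|\langle F,F'\rangle|^2$ subtracted in
  -- the Fubini–Study density is restored by the gradient.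
  have hkey : normSqSum (fun i => deriv (F i)) z / N z
      = (Δ u z + q z * (1 + u z) ^ 2) / 4 := by
    have h1 : q z * (1 + u z) ^ 2 = 4 * ‖derivPairing (withOne F) z‖ ^ 2 / N z ^ 2 := by
      rw [hq, ← hgrad]
      field_simp
    have := (hNpos z).ne'
    rw [h1, hΔ, fsDensity, normSqSum_deriv_withOne, ← hN]
    field_simp
    ring
  rw [← log_mul p1.ne' p2.ne', ← log_mul p3.ne' p3.ne', ← log_mul (by positivity) (by positivity),
    ← sq]
  refine log_le_log (by linarith [hd0 z]) ?_
  rw [hkey]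
  have a1 := hΔ0 z
  have a2 := hq0 z
  have a3 := hu0 z
  have e1 : (1 + Δ u z) * (1 + q z) * (1 + u z) ^ 2 = (1 + Δ u z) * (1 + u z) ^ 2
    + q z * (1 + u z) ^ 2 + Δ u z * (q z * (1 + u z) ^ 2) := by ring
  have e2 : 0 ≤ q z * (1 + u z) ^ 2 := by positivity
  have e4 : 1 + Δ u z ≤ (1 + Δ u z) * (1 + u z) ^ 2 :=
    le_mul_of_one_le_right p1.le (one_le_pow₀ (by linarith))
  have e5 := mul_nonneg a1 e2
  linarith

/-- The second logarithmic derivative `|F''|² / (1 + |F|²)` of an entire curve has small proximity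
function. -/
theorem SmallOutside.log_deriv_deriv (hF : ∀ i z, AnalyticAt ℂ (F i) z) :
    SmallOutside (FermatJet.charT F) fun r => circleAverage (fun z =>
      log (1 + normSqSum (fun i => deriv (deriv (F i))) z / normSqSum (withOne F) z)) 0 r := by
  have hT : ∀ r, 1 < r → 0 ≤ FermatJet.charT F r := fun r hr => charT_nonneg F (by linarith)
  -- The derivative of the curve $(F,F')$ contains $F''$, so the first order lemma applied to it
  -- yields the second order one.
  set H : ι ⊕ ι → ℂ → ℂ := Sum.elim F fun i => deriv (F i) with hH
  have hHa : ∀ i z, AnalyticAt ℂ (H i) z := by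
    rintro (i | i) z
    · exact hF i z
    · exact (hF i z).deriv
  set N := normSqSum (withOne F) with hN
  set D := normSqSum fun i => deriv (F i) with hD
  set D2 := normSqSum fun i => deriv (deriv (F i)) with hD2
  have hNH : ∀ z, normSqSum (withOne H) z = N z + D z := by
    intro z
    rw [hN, normSqSum_withOne, normSqSum_withOne]
    simp [hH, hD, normSqSum, Fintype.sum_sum_type, add_assoc]
  have hDH : ∀ z, normSqSum (fun i => deriv (H i)) z = D z + D2 z := by
    intro z
    simp [hH, hD, hD2, normSqSum, Fintype.sum_sum_type]
  have hNpos : ∀ z, 0 < N z := normSqSum_withOne_pos F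
  have hD0 : ∀ z, 0 ≤ D z := normSqSum_nonneg _
  have hD20 : ∀ z, 0 ≤ D2 z := normSqSum_nonneg _
  have hNc : Continuous N := continuous_normSqSum fun o z => analyticAt_withOne (fun i => hF i z) o
  have hDc : Continuous D := continuous_normSqSum fun i z => (hF i z).deriv
  have hD2c : Continuous D2 := continuous_normSqSum fun i z => (hF i z).deriv.deriv
  have s1 := SmallOutside.log_deriv hF
  have cN : Continuous fun z => log (N z) := hNc.log fun z => (hNpos z).ne'
  have hND : ∀ z, 0 < N z + D z := fun z => by linarith [hNpos z, hD0 z]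
  have c1 : Continuous fun z => log (1 + D z / N z) := continuous_log_one_add (hDc.div hNc fun z => (hNpos z).ne')
    fun z => div_nonneg (hD0 z) (hNpos z).le
  have c2 : Continuous fun z => log (1 + D2 z / N z) := continuous_log_one_add (hD2c.div hNc fun z => (hNpos z).ne')
    fun z => div_nonneg (hD20 z) (hNpos z).le
  have c3 : Continuous fun z => log (1 + (D z + D2 z) / (N z + D z)) :=
    continuous_log_one_add ((hDc.fun_add hD2c).div (hNc.fun_add hDc)
    fun z => (hND z).ne') fun z => div_nonneg (add_nonneg (hD0 z) (hD20 z)) (hND z).le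
  -- Writing $1+|F|^2+|F'|^2=N(1+D/N)$, the two characteristic functions differ by a term already
  -- known to be small.
  have hTH : ∀ r, 1 < r → FermatJet.charT H r - 1 * FermatJet.charT F r
      ≤ 1 / 2 * circleAverage (fun z => log (1 + D z / N z)) 0 r + log (N 0) / 2 := by
    intro r hr
    rw [charT_eq_circleAverage hF (by linarith), charT_eq_circleAverage hHa (by linarith)]
    have h1 : circleAverage (fun z => log (normSqSum (withOne H) z)) 0 r
        = circleAverage (fun z => log (N z)) 0 r
          + circleAverage (fun z => log (1 + D z / N z)) 0 r := by
      rw [← circleAverage_fun_add (circleIntegrable_of_continuous cN r)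
        (circleIntegrable_of_continuous c1 r)]
      congr 1
      ext z
      have := hNpos z
      have := hD0 z
      rw [hNH, ← log_mul (by positivity) (by positivity)]
      congr 1
      field_simp
    have h2 : 0 ≤ log (normSqSum (withOne H) 0) := log_nonneg (by
      rw [normSqSum_withOne]; linarith [normSqSum_nonneg H 0])
    linarith
  have s2 := (SmallOutside.log_deriv hHa).trans hT (fun r hr => charT_nonneg H (by linarith))
    zero_le_one (((s1.const_mul hT (by norm_num : (0 : ℝ) ≤ 1 / 2)).add hT
      (SmallOutside.const hT (log (N 0) / 2))).mono hTH)
  simp only [hNH, hDH] at s2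
  refine SmallOutside.circleAverage_mono c2 (by fun_prop) (s2.circleAverage_add hT c3 c1 s1)
    fun z => ?_
  have h0 := hNpos z
  have h1 := hD0 z
  have h2 := hD20 z
  rw [← log_mul (by positivity) (by positivity)]
  refine log_le_log (by positivity) ?_
  have : (1 + (D z + D2 z) / (N z + D z)) * (1 + D z / N z)
      = 1 + D2 z / N z + 2 * D z / N z := by
    field_simp
    ring
  rw [this]
  have : 0 ≤ 2 * D z / N z := by positivity
  linarith

end Characteristic

/-! ### The differential `xyz Φ` along a curve on the Fermat surface -/

/-- The expression `f f' (g D²g) - g g' (f D²f)`, where `f D²f = f f'' + (n - 1) f'²` and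
`n = m + 2`. -/
noncomputable def fermatWedge (m : ℕ) (f g : ℂ → ℂ) (z : ℂ) : ℂ :=
  f z * deriv f z * (g z * deriv (deriv g) z + (m + 1) * deriv g z ^ 2)
    - g z * deriv g z * (f z * deriv (deriv f) z + (m + 1) * deriv f z ^ 2)

theorem fermatWedge_congr {m : ℕ} {f g f₁ g₁ : ℂ → ℂ} {z : ℂ} (hf : f =ᶠ[𝓝 z] f₁)
    (hg : g =ᶠ[𝓝 z] g₁) : fermatWedge m f g z = fermatWedge m f₁ g₁ z := by
  simp only [fermatWedge, hf.eq_of_nhds, hg.eq_of_nhds, hf.deriv_eq, hg.deriv_eq,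
    hf.deriv.deriv_eq, hg.deriv.deriv_eq]

theorem fermatWedge_swap (m : ℕ) (f g : ℂ → ℂ) (z : ℂ) :
    fermatWedge m g f z = -fermatWedge m f g z := by
  simp only [fermatWedge]
  ring

theorem analyticAt_fermatWedge {m : ℕ} {f g : ℂ → ℂ} {z : ℂ} (hf : AnalyticAt ℂ f z)
    (hg : AnalyticAt ℂ g z) : AnalyticAt ℂ (fermatWedge m f g) z := by
  have hf1 := hf.deriv
  have hg1 := hg.deriv
  have hf2 := hf1.deriv
  have hg2 := hg1.deriv
  unfold fermatWedge
  fun_prop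

-- The factor $yz$ clears the denominators of $D^2y$ and $D^2z$, and $x$ lowers the exponent $n-1$
-- to $n-2=m$. The only remaining denominator is $f^m$.
open FermatJet in
theorem pullback_xyzPhi_eq {m : ℕ} {f g h : ℂ → ℂ} {z : ℂ} (hf : f z ≠ 0) (hg : g z ≠ 0)
    (hh : h z ≠ 0) :
    pullback ![f, g, h] (xyzPhi (m + 2)) z = fermatWedge m g h z / f z ^ m := by
  simp only [pullback, xyzPhi, Phi, jetOf, D2, fermatWedge, Matrix.det_fin_two_of]
  simp
  field_simp
  ring

/-- Differentiate the Fermat equation twice and divide by $m+2$. Both relations are linear with the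
same coefficients $f^m,g^m,h^m$. -/
theorem fermat_relations {m : ℕ} {f g h : ℂ → ℂ} {z : ℂ} (hf : AnalyticAt ℂ f z)
    (hg : AnalyticAt ℂ g z) (hh : AnalyticAt ℂ h z)
    (hrel : ∀ᶠ w in 𝓝 z, f w ^ (m + 2) + g w ^ (m + 2) + h w ^ (m + 2) = 1) :
    f z ^ m * (f z * deriv f z) + g z ^ m * (g z * deriv g z) + h z ^ m * (h z * deriv h z) = 0 ∧
    f z ^ m * (f z * deriv (deriv f) z + (m + 1) * deriv f z ^ 2)
      + g z ^ m * (g z * deriv (deriv g) z + (m + 1) * deriv g z ^ 2)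
      + h z ^ m * (h z * deriv (deriv h) z + (m + 1) * deriv h z ^ 2) = 0 := by
  have hm : (m + 2 : ℂ) ≠ 0 := by exact_mod_cast (Nat.succ_ne_zero (m + 1))
  have h1 : ∀ᶠ w in 𝓝 z, f w ^ (m + 1) * deriv f w + g w ^ (m + 1) * deriv g w
      + h w ^ (m + 1) * deriv h w = 0 := by
    filter_upwards [hrel.eventually_nhds, hf.eventually_analyticAt, hg.eventually_analyticAt,
      hh.eventually_analyticAt] with w hw hfw hgw hhw
    have hd := ((hfw.differentiableAt.hasDerivAt.fun_pow (m + 2)).fun_add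
      (hgw.differentiableAt.hasDerivAt.fun_pow (m + 2))).fun_add
      (hhw.differentiableAt.hasDerivAt.fun_pow (m + 2))
    have e := hd.deriv
    rw [(EventuallyEq.deriv_eq (f := fun _ => (1 : ℂ)) hw), deriv_const] at e
    have : (m + 2 : ℂ) * (f w ^ (m + 1) * deriv f w + g w ^ (m + 1) * deriv g w
      + h w ^ (m + 1) * deriv h w) = 0 := by
      rw [e]
      push_cast
      ring
    exact (mul_eq_zero.1 this).resolve_left hm
  refine ⟨?_, ?_⟩
  · linear_combination h1.self_of_nhds
  · have key : ∀ {k : ℂ → ℂ}, AnalyticAt ℂ k z → HasDerivAt (fun w => k w ^ (m + 1) * deriv k w)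
        (k z ^ m * (k z * deriv (deriv k) z + (m + 1) * deriv k z ^ 2)) z := by
      intro k hk
      refine ((hk.differentiableAt.hasDerivAt.fun_pow (m + 1)).fun_mul
        hk.deriv.differentiableAt.hasDerivAt).congr_deriv ?_
      push_cast
      ring
    have e := (((key hf).fun_add (key hg)).fun_add (key hh)).deriv
    rw [(EventuallyEq.deriv_eq (f := fun _ => (0 : ℂ)) h1), deriv_const] at e
    exact e.symm

/-- The cyclic symmetry of `xyz Φ`. -/
theorem fermatWedge_cyclic {m : ℕ} {f g h : ℂ → ℂ} {z : ℂ} (hf : AnalyticAt ℂ f z)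
    (hg : AnalyticAt ℂ g z) (hh : AnalyticAt ℂ h z)
    (hrel : ∀ᶠ w in 𝓝 z, f w ^ (m + 2) + g w ^ (m + 2) + h w ^ (m + 2) = 1)
    (hf0 : f z ≠ 0) (hg0 : g z ≠ 0) :
    fermatWedge m g h z / f z ^ m = fermatWedge m h f z / g z ^ m := by
  obtain ⟨h1, h2⟩ := fermat_relations hf hg hh hrel
  rw [div_eq_div_iff (pow_ne_zero m hf0) (pow_ne_zero m hg0)]
  simp only [fermatWedge]
  -- Two linear relations orthogonal to $(f^m,g^m,h^m)$: their cross product is proportional to that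
  -- vector, and this is the asserted equality of ratios.
  linear_combination (h z * deriv (deriv h) z + (m + 1) * deriv h z ^ 2) * h1
    - (h z * deriv h z) * h2

/-- The points at which the three functions form a regular point of a curve on the Fermat surface,
off the coordinate planes. -/
structure IsGoodPoint (m : ℕ) (f g h : ℂ → ℂ) (z : ℂ) : Prop where
  analytic_x : AnalyticAt ℂ f z
  analytic_y : AnalyticAt ℂ g z
  analytic_z : AnalyticAt ℂ h z
  ne_x : f z ≠ 0
  ne_y : g z ≠ 0
  ne_z : h z ≠ 0
  rel : ∀ᶠ w in 𝓝 z, f w ^ (m + 2) + g w ^ (m + 2) + h w ^ (m + 2) = 1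

namespace IsGoodPoint

open FermatJet

variable {m : ℕ} {f g h : ℂ → ℂ} {z : ℂ}

theorem cyclic (H : IsGoodPoint m f g h z) : IsGoodPoint m g h f z :=
  ⟨H.analytic_y, H.analytic_z, H.analytic_x, H.ne_y, H.ne_z, H.ne_x, by
    filter_upwards [H.rel] with w hw
    rw [← hw]; ring⟩

theorem pullback_cyclic (H : IsGoodPoint m f g h z) :
    pullback ![f, g, h] (xyzPhi (m + 2)) z = pullback ![g, h, f] (xyzPhi (m + 2)) z := by
  rw [pullback_xyzPhi_eq H.ne_x H.ne_y H.ne_z, pullback_xyzPhi_eq H.ne_y H.ne_z H.ne_x]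
  exact fermatWedge_cyclic H.analytic_x H.analytic_y H.analytic_z H.rel H.ne_x H.ne_y

end IsGoodPoint

open FermatJet in
theorem pullback_congr {f g h f₁ g₁ h₁ : ℂ → ℂ} {z : ℂ} (hf : f =ᶠ[𝓝 z] f₁) (hg : g =ᶠ[𝓝 z] g₁)
    (hh : h =ᶠ[𝓝 z] h₁) (ω : TwoJet → ℂ) : pullback ![f, g, h] ω z = pullback ![f₁, g₁, h₁] ω z := by
  have e : ∀ i, ![f, g, h] i =ᶠ[𝓝 z] ![f₁, g₁, h₁] i := by
    intro i
    fin_cases i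
    exacts [hf, hg, hh]
  have e1 : jetOf ![f, g, h] z = jetOf ![f₁, g₁, h₁] z := by
    simp only [jetOf, (e _).eq_of_nhds, (e _).deriv_eq, (e _).deriv.deriv_eq]
  rw [pullback, pullback, e1]

theorem EventuallyEq.eventually_nhdsNE {α : Type*} {f g : ℂ → α} {a : ℂ} (h : f =ᶠ[𝓝[≠] a] g) :
    ∀ᶠ z in 𝓝[≠] a, f =ᶠ[𝓝 z] g := by
  exact eventually_eventually_nhdsWithin.2 h |>.mp (eventually_mem_nhdsWithin.mono fun z hz h => by
    rwa [(isOpen_compl_singleton.nhdsWithin_eq hz)] at h)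

open FermatJet in
/-- `xyz Φ` is holomorphic along holomorphic curves on the affine Fermat surface. -/
theorem exists_analyticAt_of_analyticAt {m : ℕ} {f g h : ℂ → ℂ} {a : ℂ} (hf : AnalyticAt ℂ f a)
    (hg : AnalyticAt ℂ g a) (hh : AnalyticAt ℂ h a)
    (hgood : ∀ᶠ z in 𝓝[≠] a, IsGoodPoint m f g h z) :
    ∃ k, AnalyticAt ℂ k a ∧ pullback ![f, g, h] (xyzPhi (m + 2)) =ᶠ[𝓝[≠] a] k := by
  -- The equation persists at the centre by continuity, so some coordinate is nonzero there; its
  -- power serves as denominator after a cyclic permutation.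
  have hrel : f a ^ (m + 2) + g a ^ (m + 2) + h a ^ (m + 2) = 1 := by
    have hc : ContinuousAt (fun z => f z ^ (m + 2) + g z ^ (m + 2) + h z ^ (m + 2)) a :=
      ((hf.continuousAt.pow _).add (hg.continuousAt.pow _)).add (hh.continuousAt.pow _)
    refine tendsto_nhds_unique (l := 𝓝[≠] a) (hc.tendsto.mono_left nhdsWithin_le_nhds) ?_
    exact tendsto_const_nhds.congr' (hgood.mono fun z hz => hz.rel.self_of_nhds.symm)
  by_cases hfa : f a = 0
  · by_cases hga : g a = 0
    · have hha : h a ≠ 0 := by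
        rintro hha
        simp [hfa, hga, hha] at hrel
      refine ⟨_, (analyticAt_fermatWedge (m := m) hf hg).div (hh.pow m) (pow_ne_zero _ hha), ?_⟩
      filter_upwards [hgood] with z hz
      rw [hz.pullback_cyclic, hz.cyclic.pullback_cyclic,
        pullback_xyzPhi_eq hz.ne_z hz.ne_x hz.ne_y]
      rfl
    · refine ⟨_, (analyticAt_fermatWedge (m := m) hh hf).div (hg.pow m) (pow_ne_zero _ hga), ?_⟩
      filter_upwards [hgood] with z hz
      rw [hz.pullback_cyclic, pullback_xyzPhi_eq hz.ne_y hz.ne_z hz.ne_x]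
      rfl
  · refine ⟨_, (analyticAt_fermatWedge (m := m) hg hh).div (hf.pow m) (pow_ne_zero _ hfa), ?_⟩
    filter_upwards [hgood] with z hz
    rw [pullback_xyzPhi_eq hz.ne_x hz.ne_y hz.ne_z]
    rfl

/-- The change of `fermatWedge` under a change of affine coordinates. -/
theorem fermatWedge_inv {m : ℕ} {v w : ℂ → ℂ} {z : ℂ} (hv : AnalyticAt ℂ v z)
    (hw : AnalyticAt ℂ w z) (h0 : w z ≠ 0) :
    fermatWedge m (fun t => v t / w t) (fun t => 1 / w t) z = -fermatWedge m v w z / w z ^ 6 := by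
  have hd : ∀ᶠ t in 𝓝 z, deriv (fun t => v t / w t) t
        = (deriv v t * w t - v t * deriv w t) / w t ^ 2 ∧
      deriv (fun t => 1 / w t) t = -deriv w t / w t ^ 2 := by
    filter_upwards [hv.eventually_analyticAt, hw.eventually_analyticAt,
      hw.continuousAt.eventually_ne h0] with t h1 h2 h3
    refine ⟨deriv_fun_div h1.differentiableAt h2.differentiableAt h3, ?_⟩
    rw [deriv_fun_div (differentiableAt_const 1) h2.differentiableAt h3]
    simp
  have hv1 := hv.differentiableAt.hasDerivAt
  have hw1 := hw.differentiableAt.hasDerivAt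
  have hv2 := hv.deriv.differentiableAt.hasDerivAt
  have hw2 := hw.deriv.differentiableAt.hasDerivAt
  have e1 := (((hv2.fun_mul hw1).fun_sub (hv1.fun_mul hw2)).fun_div (hw1.fun_pow 2)
    (pow_ne_zero 2 h0)).deriv
  have e2 := (hw2.fun_neg.fun_div (hw1.fun_pow 2) (pow_ne_zero 2 h0)).deriv
  have d1 : deriv (deriv fun t => v t / w t) z = _ :=
    (EventuallyEq.deriv_eq (hd.mono fun t ht => ht.1)).trans e1
  have d2 : deriv (deriv fun t => 1 / w t) z = _ :=
    (EventuallyEq.deriv_eq (hd.mono fun t ht => ht.2)).trans e2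
  -- The exponent $6$ of $w$ in the result does not depend on $m$; it equals $m$ only in degree $8$,
  -- where the powers of $w$ cancel in the quotient.
  simp only [fermatWedge, d1, d2, hd.self_of_nhds.1, hd.self_of_nhds.2]
  push_cast
  field_simp
  ring

/-! ### Extension over exceptional points -/

theorem eventually_codiscrete_iff {p : ℂ → Prop} :
    (∀ᶠ z in codiscrete ℂ, p z) ↔ ∀ a, ∀ᶠ z in 𝓝[≠] a, p z := by
  simp only [Filter.Eventually, mem_codiscrete, disjoint_principal_right, compl_compl]

/-- Passing to neighbourhoods allows identities valid off a discrete set to be differentiated. -/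
theorem eventually_codiscrete_nhds {p : ℂ → Prop} (h : ∀ᶠ z in codiscrete ℂ, p z) :
    ∀ᶠ z in codiscrete ℂ, ∀ᶠ w in 𝓝 z, p w := by
  rw [eventually_codiscrete_iff] at h ⊢
  intro a
  have h1 := eventually_eventually_nhdsWithin.2 (h a)
  filter_upwards [h1, eventually_mem_nhdsWithin] with z hz hza
  rwa [isOpen_compl_singleton.nhdsWithin_eq hza] at hz

/-- A function that agrees near every point, except possibly at the point itself, with a continuous
function, is modified on a discrete set to a function that agrees locally with all of these. -/
theorem exists_codiscrete_extension {Y : Type*} [TopologicalSpace Y] [T2Space Y] {p : ℂ → Y}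
    (hloc : ∀ a, ∃ k : ℂ → Y, (∀ᶠ z in 𝓝 a, ContinuousAt k z) ∧ p =ᶠ[𝓝[≠] a] k) :
    ∃ q : ℂ → Y, (∀ᶠ z in codiscrete ℂ, p z = q z) ∧
      ∀ a k, (∀ᶠ z in 𝓝 a, ContinuousAt k z) → p =ᶠ[𝓝[≠] a] k → q =ᶠ[𝓝 a] k := by
  choose K hKc hK using hloc
  -- The extension takes at $z$ the value of the local model centred at $z$, that is, the limit of
  -- $p$ over the punctured neighbourhoods. Uniqueness of limits identifies it with any other model.
  have main : ∀ a k, (∀ᶠ z in 𝓝 a, ContinuousAt k z) → p =ᶠ[𝓝[≠] a] k →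
      (fun z => K z z) =ᶠ[𝓝 a] k := by
    intro a k hkc hk
    have hk' : ∀ᶠ z in 𝓝 a, p =ᶠ[𝓝[≠] z] k := by
      have := EventuallyEq.eventually_nhdsNE hk
      rw [eventually_nhdsWithin_iff] at this
      filter_upwards [this] with z hz
      by_cases hza : z = a
      · rw [hza]; exact hk
      · exact (hz hza).filter_mono nhdsWithin_le_nhds
    filter_upwards [hkc, hk'] with z hz1 hz2
    have h1 : Tendsto (K z) (𝓝[≠] z) (𝓝 (K z z)) :=
      (hKc z).self_of_nhds.tendsto.mono_left nhdsWithin_le_nhds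
    have h2 : Tendsto k (𝓝[≠] z) (𝓝 (k z)) := hz1.tendsto.mono_left nhdsWithin_le_nhds
    exact tendsto_nhds_unique (h1.congr' (hK z).symm) (h2.congr' hz2.symm)
  refine ⟨fun z => K z z, ?_, main⟩
  rw [eventually_codiscrete_iff]
  intro a
  filter_upwards [hK a, (main a _ (hKc a) (hK a)).filter_mono nhdsWithin_le_nhds] with z h1 h2
  rw [h1, h2]

theorem exists_entire_extension {p : ℂ → ℂ}
    (hloc : ∀ a, ∃ k, AnalyticAt ℂ k a ∧ p =ᶠ[𝓝[≠] a] k) :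
    ∃ q : ℂ → ℂ, (∀ z, AnalyticAt ℂ q z) ∧ ∀ᶠ z in codiscrete ℂ, p z = q z := by
  have hc : ∀ {k : ℂ → ℂ} {a}, AnalyticAt ℂ k a → ∀ᶠ z in 𝓝 a, ContinuousAt k z :=
    fun hk => hk.eventually_analyticAt.mono fun z hz => hz.continuousAt
  obtain ⟨q, hq1, hq2⟩ := exists_codiscrete_extension (p := p) fun a =>
    (hloc a).imp fun k hk => ⟨hc hk.1, hk.2⟩
  refine ⟨q, fun a => ?_, hq1⟩
  obtain ⟨k, hk, hpk⟩ := hloc a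
  exact hk.congr (hq2 a k (hc hk) hpk).symm

theorem exists_contDiff_extension {p : ℂ → ℝ}
    (hloc : ∀ a, ∃ k, ContDiffAt ℝ 2 k a ∧ p =ᶠ[𝓝[≠] a] k) :
    ∃ q : ℂ → ℝ, ContDiff ℝ 2 q ∧ ∀ᶠ z in codiscrete ℂ, p z = q z := by
  have hc : ∀ {k : ℂ → ℝ} {a}, ContDiffAt ℝ 2 k a → ∀ᶠ z in 𝓝 a, ContinuousAt k z :=
    fun hk => (hk.eventually (by norm_num)).mono fun z hz => hz.continuousAt
  obtain ⟨q, hq1, hq2⟩ := exists_codiscrete_extension (p := p) fun a =>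
    (hloc a).imp fun k hk => ⟨hc hk.1, hk.2⟩
  refine ⟨q, contDiff_iff_contDiffAt.2 fun a => ?_, hq1⟩
  obtain ⟨k, hk, hpk⟩ := hloc a
  exact hk.congr_of_eventuallyEq (hq2 a k (hc hk) hpk)

theorem le_of_eventually_codiscrete {p q : ℂ → ℝ} (hp : Continuous p) (hq : Continuous q)
    (h : ∀ᶠ z in codiscrete ℂ, p z ≤ q z) (a : ℂ) : p a ≤ q a :=
  le_of_tendsto_of_tendsto (b := 𝓝[≠] a) (hp.continuousAt.tendsto.mono_left nhdsWithin_le_nhds)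
    (hq.continuousAt.tendsto.mono_left nhdsWithin_le_nhds) (eventually_codiscrete_iff.1 h a)

/-- The identity theorem: on the connected plane the order is infinite everywhere or nowhere. -/
theorem Meromorphic.eventually_zero_or_ne_zero {f : ℂ → ℂ} (hf : Meromorphic f) :
    (∀ᶠ z in codiscrete ℂ, f z = 0) ∨ ∀ᶠ z in codiscrete ℂ, f z ≠ 0 := by
  simp only [eventually_codiscrete_iff]
  have h := MeromorphicOn.exists_meromorphicOrderAt_ne_top_iff_forall (U := univ) (f := f)
    (fun z _ => hf z) isConnected_univ
  by_cases h1 : ∃ u : (univ : Set ℂ), meromorphicOrderAt f u ≠ ⊤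
  · exact Or.inr fun a =>
      (meromorphicOrderAt_ne_top_iff_eventually_ne_zero (hf a)).1 (h.1 h1 ⟨a, mem_univ a⟩)
  · push Not at h1
    exact Or.inl fun a => meromorphicOrderAt_eq_top_iff.1 (h1 ⟨a, mem_univ a⟩)

/-! ### Poles of the curve and charts at infinity. -/

/-- A meromorphic function of nonnegative order agrees with an analytic function. -/
theorem MeromorphicAt.exists_analyticAt {f : ℂ → ℂ} {a : ℂ} (hf : MeromorphicAt f a)
    (h : 0 ≤ meromorphicOrderAt f a) : ∃ k, AnalyticAt ℂ k a ∧ f =ᶠ[𝓝[≠] a] k :=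
  ⟨_, hf.meromorphicOrderAt_nonneg_iff_analyticAt_toMeromorphicNFAt.1 h,
    hf.eq_nhdsNE_toMeromorphicNFAt⟩

/-- Affine coordinates in a chart at infinity, at a point where `f` has a pole of maximal order. -/
theorem exists_coordinates_at_pole {f g h : ℂ → ℂ} {a : ℂ} (hf : MeromorphicAt f a)
    (hg : MeromorphicAt g a) (hh : MeromorphicAt h a) (hpole : meromorphicOrderAt f a < 0)
    (hfg : meromorphicOrderAt f a ≤ meromorphicOrderAt g a)
    (hfh : meromorphicOrderAt f a ≤ meromorphicOrderAt h a) :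
    ∃ u v w : ℂ → ℂ, AnalyticAt ℂ u a ∧ AnalyticAt ℂ v a ∧ AnalyticAt ℂ w a ∧ w a = 0 ∧
      f =ᶠ[𝓝[≠] a] (fun z => 1 / w z) ∧ g =ᶠ[𝓝[≠] a] (fun z => u z / w z) ∧
      h =ᶠ[𝓝[≠] a] (fun z => v z / w z) := by
  have hne : ∀ᶠ z in 𝓝[≠] a, f z ≠ 0 :=
    (meromorphicOrderAt_ne_top_iff_eventually_ne_zero hf).1 (ne_top_of_lt hpole)
  have hsub : ∀ {k : ℂ → ℂ}, MeromorphicAt k a →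
      meromorphicOrderAt f a ≤ meromorphicOrderAt k a → 0 ≤ meromorphicOrderAt (k * f⁻¹) a := by
    intro k hk hle
    rw [meromorphicOrderAt_mul hk hf.inv, meromorphicOrderAt_inv]
    lift meromorphicOrderAt f a to ℤ using ne_top_of_lt hpole with n
    cases hord : meromorphicOrderAt k a with
    | top => exact le_top
    | coe m =>
      rw [hord] at hle
      have : n ≤ m := by exact_mod_cast hle
      have : (0 : ℤ) ≤ m + -n := by linarith
      exact_mod_cast this
  obtain ⟨u, hu, hgu⟩ := (hg.mul hf.inv).exists_analyticAt (hsub hg hfg)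
  obtain ⟨v, hv, hhv⟩ := (hh.mul hf.inv).exists_analyticAt (hsub hh hfh)
  have hpos : 0 < meromorphicOrderAt f⁻¹ a := by
    rw [meromorphicOrderAt_inv]
    lift meromorphicOrderAt f a to ℤ using ne_top_of_lt hpole with n
    have : n < 0 := by exact_mod_cast hpole
    have : (0 : ℤ) < -n := by linarith
    exact_mod_cast this
  obtain ⟨w, hw, hfw⟩ := hf.inv.exists_analyticAt hpos.le
  refine ⟨u, v, w, hu, hv, hw, ?_, ?_, ?_, ?_⟩
  · exact tendsto_nhds_unique (l := 𝓝[≠] a)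
      (hw.continuousAt.tendsto.mono_left nhdsWithin_le_nhds)
      ((tendsto_zero_of_meromorphicOrderAt_pos hpos).congr' hfw)
  · filter_upwards [hfw] with z hz
    rw [← hz]; simp
  · filter_upwards [hfw, hgu, hne] with z hz hz' h0
    rw [← hz, ← hz']; simp [h0]
  · filter_upwards [hfw, hhv, hne] with z hz hz' h0
    rw [← hz, ← hz']; simp [h0]

open FermatJet

theorem IsGoodPoint.congr {m : ℕ} {f g h f₁ g₁ h₁ : ℂ → ℂ} {z : ℂ} (H : IsGoodPoint m f g h z)
    (hf : f =ᶠ[𝓝 z] f₁) (hg : g =ᶠ[𝓝 z] g₁) (hh : h =ᶠ[𝓝 z] h₁) : IsGoodPoint m f₁ g₁ h₁ z :=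
  ⟨H.analytic_x.congr hf, H.analytic_y.congr hg, H.analytic_z.congr hh,
    hf.eq_of_nhds ▸ H.ne_x, hg.eq_of_nhds ▸ H.ne_y, hh.eq_of_nhds ▸ H.ne_z, by
    filter_upwards [H.rel, hf, hg, hh] with w hw h1 h2 h3
    rwa [← h1, ← h2, ← h3]⟩

/-- `xyz Φ` is holomorphic along a meromorphic curve on the Fermat surface of degree `8` at a pole,
and the Fubini–Study density extends smoothly. -/
theorem exists_extension_at_pole {f g h : ℂ → ℂ} {a : ℂ} (hf : MeromorphicAt f a)
    (hg : MeromorphicAt g a) (hh : MeromorphicAt h a) (hpole : meromorphicOrderAt f a < 0)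
    (hfg : meromorphicOrderAt f a ≤ meromorphicOrderAt g a)
    (hfh : meromorphicOrderAt f a ≤ meromorphicOrderAt h a)
    (hgood : ∀ᶠ z in 𝓝[≠] a, IsGoodPoint 6 f g h z) :
    (∃ k, AnalyticAt ℂ k a ∧ pullback ![f, g, h] (xyzPhi 8) =ᶠ[𝓝[≠] a] k) ∧
      ∃ k, ContDiffAt ℝ 2 k a ∧ fsDensity (withOne ![f, g, h]) =ᶠ[𝓝[≠] a] k := by
  obtain ⟨u, v, w, hu, hv, hw, hw0, hfw, hgu, hhv⟩ :=
    exists_coordinates_at_pole hf hg hh hpole hfg hfh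
  have hfw' := EventuallyEq.eventually_nhdsNE hfw
  have hgu' := EventuallyEq.eventually_nhdsNE hgu
  have hhv' := EventuallyEq.eventually_nhdsNE hhv
  have hev : ∀ {k : ℂ → ℂ}, AnalyticAt ℂ k a → ∀ᶠ z in 𝓝[≠] a, AnalyticAt ℂ k z := fun hk =>
    hk.eventually_analyticAt.filter_mono nhdsWithin_le_nhds
  have hwne : ∀ᶠ z in 𝓝[≠] a, w z ≠ 0 := by
    filter_upwards [hgood, hfw] with z hz hz' h0
    exact hz.ne_x (by rw [hz', h0, div_zero])
  -- Homogenised, the equation reads $1+u^8+v^8=w^8$, and $w$ vanishes at the pole; hence $u$ and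
  -- $v$ do not both vanish there.
  have hrel : u a ^ 8 + v a ^ 8 = -1 := by
    have hc : ContinuousAt (fun z => u z ^ 8 + v z ^ 8 - w z ^ 8) a :=
      ((hu.continuousAt.pow _).add (hv.continuousAt.pow _)).sub (hw.continuousAt.pow _)
    have := tendsto_nhds_unique (l := 𝓝[≠] a) (hc.tendsto.mono_left nhdsWithin_le_nhds)
      (tendsto_const_nhds (x := (-1 : ℂ)) |>.congr' ?_)
    · simpa [hw0] using this
    · filter_upwards [hgood, hfw, hgu, hhv, hwne] with z hz h1 h2 h3 h4
      have := hz.rel.self_of_nhds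
      rw [h1, h2, h3] at this
      simp only [div_pow, one_pow, Nat.reduceAdd] at this
      field_simp at this
      linear_combination -this
  refine ⟨?_, ?_⟩
  -- Only the forms of $xyz\Phi$ with denominator $g^6=u^6/w^6$ or $h^6=v^6/w^6$ are used. Their
  -- numerators carry the same factor $w^{-6}$.
  · by_cases hua : u a = 0
    · have hva : v a ≠ 0 := by
        intro hva
        simp [hua, hva] at hrel
      refine ⟨_, (analyticAt_fermatWedge (m := 6) hu hw).div (hv.pow 6) (pow_ne_zero _ hva), ?_⟩
      filter_upwards [hgood, hfw', hgu', hhv', hwne, hev hu, hev hv, hev hw] with z hz h1 h2 h3 h4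
        h5 h6 h7
      rw [hz.pullback_cyclic, hz.cyclic.pullback_cyclic,
        pullback_xyzPhi_eq hz.ne_z hz.ne_x hz.ne_y, fermatWedge_swap, fermatWedge_congr h2 h1,
        fermatWedge_inv h5 h7 h4, h3.eq_of_nhds]
      have : v z ≠ 0 := fun h0 => hz.ne_z (by rw [h3.eq_of_nhds, h0, zero_div])
      simp only [Pi.div_apply, Pi.pow_apply]
      field_simp
    · refine ⟨_, (analyticAt_fermatWedge (m := 6) hv hw).neg.div (hu.pow 6)
        (pow_ne_zero _ hua), ?_⟩
      filter_upwards [hgood, hfw', hgu', hhv', hwne, hev hu, hev hv, hev hw] with z hz h1 h2 h3 h4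
        h5 h6 h7
      rw [hz.pullback_cyclic, pullback_xyzPhi_eq hz.ne_y hz.ne_z hz.ne_x, fermatWedge_congr h3 h1,
        fermatWedge_inv h6 h7 h4, h2.eq_of_nhds]
      have : u z ≠ 0 := fun h0 => hz.ne_y (by rw [h2.eq_of_nhds, h0, zero_div])
      simp only [Pi.div_apply, Pi.pow_apply, Pi.neg_apply]
      field_simp
  -- The homogeneous coordinates $[w,1,u,v]$ are holomorphic without common zero and differ from
  -- $[1,f,g,h]$ by the factor $w$, to which the density is insensitive.
  · set H : Option (Fin 3) → ℂ → ℂ := fun o => o.elim w ![fun _ => 1, u, v] with hH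
    have hHa : ∀ {z}, AnalyticAt ℂ u z → AnalyticAt ℂ v z → AnalyticAt ℂ w z →
        ∀ o, AnalyticAt ℂ (H o) z := by
      intro z h1 h2 h3 o
      cases o with
      | none => exact h3
      | some i =>
        fin_cases i
        exacts [analyticAt_const, h1, h2]
    refine ⟨fsDensity H, contDiffAt_fsDensity (hHa hu hv hw)
      (normSqSum_pos (i := some 0) (by simp [hH])).ne', ?_⟩
    filter_upwards [hgood, hfw', hgu', hhv', hwne, hev hu, hev hv, hev hw] with z hz h1 h2 h3 h4
      h5 h6 h7
    rw [← fsDensity_mul (lam := fun t => 1 / w t) (fun o => (hHa h5 h6 h7 o).differentiableAt)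
      ((differentiableAt_const 1).fun_div h7.differentiableAt h4) (by simp [h4])]
    refine fsDensity_congr fun o => ?_
    have hw1 := h7.continuousAt.eventually_ne h4
    cases o with
    | none =>
      filter_upwards [hw1] with t ht
      simp [withOne, hH, ht]
    | some i =>
      fin_cases i
      · filter_upwards [h1] with t ht
        simp [withOne, hH, ht]
      · filter_upwards [h2] with t ht
        simp [withOne, hH, ht, div_eq_inv_mul]
      · filter_upwards [h3] with t ht
        simp [withOne, hH, ht, div_eq_inv_mul]

theorem fsDensity_withOne_cyclic (f g h : ℂ → ℂ) (z : ℂ) :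
    fsDensity (withOne ![g, h, f]) z = fsDensity (withOne ![f, g, h]) z := by
  have e1 : normSqSum (withOne ![g, h, f]) z = normSqSum (withOne ![f, g, h]) z := by
    simp [normSqSum, withOne, Fintype.sum_option, Fin.sum_univ_three]; ring
  have e2 : normSqSum (fun i => deriv (withOne ![g, h, f] i)) z
      = normSqSum (fun i => deriv (withOne ![f, g, h] i)) z := by
    simp [normSqSum, withOne, Fintype.sum_option, Fin.sum_univ_three]; ring
  have e3 : derivPairing (withOne ![g, h, f]) z = derivPairing (withOne ![f, g, h]) z := by
    simp [derivPairing, withOne, Fintype.sum_option, Fin.sum_univ_three]; ring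
  rw [fsDensity, fsDensity, e1, e2, e3]

theorem exists_local_extension {f g h : ℂ → ℂ} {a : ℂ} (hf : MeromorphicAt f a)
    (hg : MeromorphicAt g a) (hh : MeromorphicAt h a)
    (hgood : ∀ᶠ z in 𝓝[≠] a, IsGoodPoint 6 f g h z) :
    (∃ k, AnalyticAt ℂ k a ∧ pullback ![f, g, h] (xyzPhi 8) =ᶠ[𝓝[≠] a] k) ∧
      ∃ k, ContDiffAt ℝ 2 k a ∧ fsDensity (withOne ![f, g, h]) =ᶠ[𝓝[≠] a] k := by
  by_cases hreg : 0 ≤ meromorphicOrderAt f a ∧ 0 ≤ meromorphicOrderAt g a ∧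
      0 ≤ meromorphicOrderAt h a
  · obtain ⟨f₁, hf₁, hff⟩ := hf.exists_analyticAt hreg.1
    obtain ⟨g₁, hg₁, hgg⟩ := hg.exists_analyticAt hreg.2.1
    obtain ⟨h₁, hh₁, hhh⟩ := hh.exists_analyticAt hreg.2.2
    have hff' := EventuallyEq.eventually_nhdsNE hff
    have hgg' := EventuallyEq.eventually_nhdsNE hgg
    have hhh' := EventuallyEq.eventually_nhdsNE hhh
    have hgood₁ : ∀ᶠ z in 𝓝[≠] a, IsGoodPoint 6 f₁ g₁ h₁ z := by
      filter_upwards [hgood, hff', hgg', hhh'] with z hz h1 h2 h3 using hz.congr h1 h2 h3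
    refine ⟨?_, fsDensity (withOne ![f₁, g₁, h₁]), contDiffAt_fsDensity (analyticAt_withOne ?_)
      (normSqSum_withOne_pos _ a).ne', ?_⟩
    · obtain ⟨k, hk, hpk⟩ := exists_analyticAt_of_analyticAt hf₁ hg₁ hh₁ hgood₁
      refine ⟨k, hk, ?_⟩
      filter_upwards [hpk, hff', hgg', hhh'] with z hz h1 h2 h3
      rw [← hz, pullback_congr h1 h2 h3]
    · intro i
      fin_cases i
      exacts [hf₁, hg₁, hh₁]
    · filter_upwards [hff', hgg', hhh'] with z h1 h2 h3
      refine fsDensity_congr fun o => ?_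
      cases o with
      | none => exact EventuallyEq.rfl
      | some i =>
        fin_cases i
        exacts [h1, h2, h3]
  · have hgood' := hgood.mono fun z hz => hz.cyclic
    have hgood'' := hgood'.mono fun z hz => hz.cyclic
    -- A cyclic permutation brings the coordinate with the highest pole to the first place.
    have hmin : (meromorphicOrderAt f a < 0 ∧ meromorphicOrderAt f a ≤ meromorphicOrderAt g a ∧
          meromorphicOrderAt f a ≤ meromorphicOrderAt h a) ∨
        (meromorphicOrderAt g a < 0 ∧ meromorphicOrderAt g a ≤ meromorphicOrderAt h a ∧
          meromorphicOrderAt g a ≤ meromorphicOrderAt f a) ∨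
        (meromorphicOrderAt h a < 0 ∧ meromorphicOrderAt h a ≤ meromorphicOrderAt f a ∧
          meromorphicOrderAt h a ≤ meromorphicOrderAt g a) := by
      generalize meromorphicOrderAt f a = x at *
      generalize meromorphicOrderAt g a = y at *
      generalize meromorphicOrderAt h a = z at *
      have hneg : x < 0 ∨ y < 0 ∨ z < 0 := by
        by_contra! hc
        exact hreg hc
      rcases le_total x y with h1 | h1 <;> rcases le_total y z with h2 | h2 <;>
        rcases le_total x z with h3 | h3 <;> rcases hneg with h4 | h4 | h4 <;> grind
    rcases hmin with ⟨h1, h2, h3⟩ | ⟨h1, h2, h3⟩ | ⟨h1, h2, h3⟩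
    · exact exists_extension_at_pole hf hg hh h1 h2 h3 hgood
    · obtain ⟨⟨k, hk, hpk⟩, l, hl, hql⟩ := exists_extension_at_pole hg hh hf h1 h2 h3 hgood'
      refine ⟨⟨k, hk, ?_⟩, l, hl, ?_⟩
      · filter_upwards [hpk, hgood] with z hz hz'
        rw [← hz, hz'.pullback_cyclic]
      · filter_upwards [hql] with z hz
        rw [← hz]
        exact (fsDensity_withOne_cyclic f g h z).symm
    · obtain ⟨⟨k, hk, hpk⟩, l, hl, hql⟩ := exists_extension_at_pole hh hf hg h1 h2 h3 hgood''
      refine ⟨⟨k, hk, ?_⟩, l, hl, ?_⟩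
      · filter_upwards [hpk, hgood] with z hz hz'
        rw [← hz, hz'.pullback_cyclic, hz'.cyclic.pullback_cyclic]
      · filter_upwards [hql] with z hz
        rw [← hz]
        exact ((fsDensity_withOne_cyclic g h f z).trans (fsDensity_withOne_cyclic f g h z)).symm

/-! ### The associated curve of order one -/

section AssociatedCurve

variable {κ : Type*}

/-- The curve with homogeneous coordinates `(G i G j, G i G j' - G j G i')`, a smooth form of the
first associated curve of the curve with homogeneous coordinates `G`. -/
noncomputable def associatedCurve (G : κ → ℂ → ℂ) : (κ × κ) ⊕ (κ × κ) → ℂ → ℂ :=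
  Sum.elim (fun p z => G p.1 z * G p.2 z)
    fun p z => G p.1 z * deriv (G p.2) z - G p.2 z * deriv (G p.1) z

theorem analyticAt_associatedCurve {G : κ → ℂ → ℂ} {z : ℂ} (h : ∀ i, AnalyticAt ℂ (G i) z) (p) :
    AnalyticAt ℂ (associatedCurve G p) z := by
  rcases p with p | p
  · exact (h p.1).mul (h p.2)
  · exact ((h p.1).mul (h p.2).deriv).sub ((h p.2).mul (h p.1).deriv)

variable [Fintype κ]

/-- The products contribute $|G|^4$ and the minors $2|G\wedge G'|^2$. The products keep the norm
positive where the minors vanish, so its logarithm stays smooth. -/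
theorem normSqSum_associatedCurve {G : κ → ℂ → ℂ} {z : ℂ} (h0 : normSqSum G z ≠ 0) :
    normSqSum (associatedCurve G) z = normSqSum G z ^ 2 * (1 + 2 * fsDensity G z) := by
  have h1 : normSqSum (associatedCurve G) z = normSqSum G z ^ 2
      + ∑ i, ∑ j, ‖G i z * deriv (G j) z - G j z * deriv (G i) z‖ ^ 2 := by
    simp only [normSqSum, associatedCurve, Fintype.sum_sum_type, Fintype.sum_prod_type,
      Sum.elim_inl, Sum.elim_inr, norm_mul, mul_pow, sq (∑ i, ‖G i z‖ ^ 2), Finset.sum_mul_sum]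
  rw [h1, fsDensity_eq_sum]
  field_simp

variable {ι : Type*} [Fintype ι]

/-- The Fubini–Study density of the associated curve in terms of the density of the curve. -/
theorem fsDensity_associatedCurve {F : ι → ℂ → ℂ} {η : ℂ → ℝ} (hη : ContDiff ℝ 2 η)
    (hη0 : ∀ z, 0 ≤ η z) {z : ℂ} (hF : ∀ i, AnalyticAt ℂ (F i) z)
    (hd : fsDensity (withOne F) =ᶠ[𝓝 z] η) :
    fsDensity (associatedCurve (withOne F)) z
      = 2 * η z + 1 / 4 * Δ (fun z => log (1 + 2 * η z)) z := by
  have hF1 := analyticAt_withOne hF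
  have hN := normSqSum_withOne_pos F
  have hA : ∀ᶠ w in 𝓝 z, normSqSum (associatedCurve (withOne F)) w
      = normSqSum (withOne F) w ^ 2 * (1 + 2 * η w) := by
    filter_upwards [hd] with w hw
    rw [normSqSum_associatedCurve (hN w).ne', hw]
  have hp : ∀ w, 0 < 1 + 2 * η w := fun w => by linarith [hη0 w]
  have hA0 : normSqSum (associatedCurve (withOne F)) z ≠ 0 := by
    rw [hA.self_of_nhds]
    exact (mul_pos (pow_pos (hN z) 2) (hp z)).ne'
  have hlog : (fun w => log (normSqSum (associatedCurve (withOne F)) w)) =ᶠ[𝓝 z]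
      ((2 : ℝ) • fun w => log (normSqSum (withOne F) w)) + fun w => log (1 + 2 * η w) := by
    filter_upwards [hA] with w hw
    rw [hw, log_mul (pow_pos (hN w) 2).ne' (hp w).ne', log_pow]
    simp
  have c1 : ContDiffAt ℝ 2 (fun w => log (normSqSum (withOne F) w)) z :=
    (contDiffAt_normSqSum hF1).log (hN z).ne'
  have c2 : ContDiffAt ℝ 2 (fun w => log (1 + 2 * η w)) z :=
    (contDiff_const.add (contDiff_const.mul hη)).contDiffAt.log (hp z).ne'
  have e := (InnerProductSpace.laplacian_congr_nhds hlog).self_of_nhds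
  rw [laplacian_log_normSqSum (analyticAt_associatedCurve hF1) hA0,
    ContDiffAt.laplacian_add (f₁ := (2 : ℝ) • fun w => log (normSqSum (withOne F) w))
      (c1.const_smul (2 : ℝ)) c2, InnerProductSpace.laplacian_smul _ c1,
    laplacian_log_normSqSum hF1 (hN z).ne', hd.self_of_nhds] at e
  simp only [smul_eq_mul] at e
  linarith

/-- Minors of $[1,F]$ involving the constant coordinate are the derivatives $F_k'$, so the left side
is a minor of the associated curve and its derivative. -/
theorem sq_norm_deriv_wronskian_le (F : ι → ℂ → ℂ) (z : ℂ) (i j : ι) :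
    ‖deriv (F i) z * deriv (deriv (F j)) z - deriv (F j) z * deriv (deriv (F i)) z‖ ^ 2
      ≤ fsDensity (associatedCurve (withOne F)) z
        * (normSqSum (withOne F) z ^ 2 * (1 + 2 * fsDensity (withOne F) z)) ^ 2 := by
  have hN := normSqSum_withOne_pos F z
  have hpos : 0 < normSqSum (associatedCurve (withOne F)) z := by
    rw [normSqSum_associatedCurve hN.ne']
    have := fsDensity_nonneg (withOne F) z
    positivity
  have h := sq_norm_wronskian_le_fsDensity hpos (Sum.inr (none, some i)) (Sum.inr (none, some j))
  have e : ∀ k, associatedCurve (withOne F) (Sum.inr (none, some k)) = deriv (F k) := by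
    intro k
    ext t
    simp [associatedCurve, withOne]
  rwa [e, e, normSqSum_associatedCurve hN.ne'] at h

open FermatJet in
/-- The proximity functions of the first and second derivatives of a curve with values in
projective space, measured by the Fubini–Study metric, are small. -/
theorem exists_fsDensity_associatedCurve_extension {F : ι → ℂ → ℂ} {η : ℂ → ℝ}
    (hη : ContDiff ℝ 2 η) (hd : ∀ᶠ z in codiscrete ℂ, fsDensity (withOne F) z = η z)
    (hF : ∀ᶠ z in codiscrete ℂ, ∀ i, AnalyticAt ℂ (F i) z) :
    SmallOutside (charT F) (fun r => circleAverage (fun z => log (1 + η z)) 0 r) ∧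
    ∃ θ : ℂ → ℝ, Continuous θ ∧ (∀ z, 0 ≤ θ z) ∧
      (∀ᶠ z in codiscrete ℂ, fsDensity (associatedCurve (withOne F)) z = θ z) ∧
      SmallOutside (charT F) fun r => circleAverage (fun z => log (1 + θ z)) 0 r := by
  have hηc := hη.continuous
  have hη0 : ∀ z, 0 ≤ η z := le_of_eventually_codiscrete continuous_const hηc
    (hd.mono fun z hz => hz ▸ fsDensity_nonneg _ z)
  have hT : ∀ r, 1 < r → 0 ≤ charT F r := fun r hr => charT_nonneg F (by linarith)
  have hJ : ∀ r, 1 < r → logIntegral η r = π * charT F r := fun r hr => by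
    rw [charT_eq_logIntegral hηc hd (by linarith), ← mul_assoc, mul_inv_cancel₀ pi_ne_zero, one_mul]
  have s1 : SmallOutside (charT F) fun r => circleAverage (fun z => log (1 + η z)) 0 r :=
    (SmallOutside.circleAverage_log hηc hη0).trans hT
      (fun r hr => logIntegral_nonneg hη0 (by linarith)) pi_pos.le
      ((SmallOutside.const hT 0).mono fun r hr => by rw [hJ r hr, sub_self])
  refine ⟨s1, ?_⟩
  have hφ : ContDiff ℝ 2 fun z => log (1 + 2 * η z) := contDiff_iff_contDiffAt.2 fun z =>
    (contDiff_const.add (contDiff_const.mul hη)).contDiffAt.log (by linarith [hη0 z])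
  have hφΔ := continuous_laplacian hφ
  -- A continuous extension of the density of the associated curve. By Jensen's formula its
  -- logarithmic integral is at most $2\pi T$ plus $\pi/2$ times the average of $\log(1+2\eta)$,
  -- already known to be small.
  set θ : ℂ → ℝ := fun z => 2 * η z + 1 / 4 * Δ (fun z => log (1 + 2 * η z)) z with hθ
  have hθc : Continuous θ := by fun_prop
  have hθd : ∀ᶠ z in codiscrete ℂ, fsDensity (associatedCurve (withOne F)) z = θ z := by
    filter_upwards [hF, eventually_codiscrete_nhds hd] with z h1 h2
    exact fsDensity_associatedCurve hη hη0 h1 h2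
  have hθ0 : ∀ z, 0 ≤ θ z := le_of_eventually_codiscrete continuous_const hθc
    (hθd.mono fun z hz => hz ▸ fsDensity_nonneg _ z)
  refine ⟨θ, hθc, hθ0, hθd, ?_⟩
  have c1 := continuous_log_one_add hηc hη0
  have c2 := continuous_log_one_add (hηc.const_mul 2) fun z => mul_nonneg zero_le_two (hη0 z)
  have s2 : SmallOutside (charT F) fun r => circleAverage (fun z => log (1 + 2 * η z)) 0 r := by
    refine SmallOutside.circleAverage_mono c2 (by fun_prop) (s1.circleAverage_add hT c1 c1 s1)
      fun z => ?_
    have := hη0 z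
    rw [← log_mul (by positivity) (by positivity)]
    exact log_le_log (by positivity) (by nlinarith)
  refine (SmallOutside.circleAverage_log hθc hθ0).trans hT
    (fun r hr => logIntegral_nonneg hθ0 (by linarith)) (by positivity : 0 ≤ 2 * π)
    ((s2.const_mul hT (by positivity : 0 ≤ π / 2)).mono fun r hr => ?_)
  rw [hθ, logIntegral_add (by fun_prop) (by fun_prop), logIntegral_const_mul,
    logIntegral_const_mul, hJ r hr, logIntegral_laplacian hφ (by linarith)]
  have : 0 ≤ log (1 + 2 * η 0) := log_nonneg (by linarith [hη0 0])
  nlinarith [pi_pos, mul_nonneg pi_pos.le this]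

end AssociatedCurve

/-! ### Pointwise estimates for `xyz Φ` -/

theorem sq_norm_add_le (a b : ℂ) : ‖a + b‖ ^ 2 ≤ 2 * (‖a‖ ^ 2 + ‖b‖ ^ 2) := by
  have h1 := norm_add_le a b
  have h2 := norm_nonneg (a + b)
  nlinarith [sq_nonneg (‖a‖ - ‖b‖)]

theorem sq_norm_sub_le (a b : ℂ) : ‖a - b‖ ^ 2 ≤ 2 * (‖a‖ ^ 2 + ‖b‖ ^ 2) := by
  have := sq_norm_add_le a (-b)
  rwa [norm_neg, ← sub_eq_add_neg] at this

theorem sq_norm_fermatWedge_le (m : ℕ) (g h : ℂ → ℂ) (z : ℂ) :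
    ‖fermatWedge m g h z‖ ^ 2 ≤ 2 * (‖g z‖ ^ 2 * ‖h z‖ ^ 2 *
        ‖deriv g z * deriv (deriv h) z - deriv h z * deriv (deriv g) z‖ ^ 2
      + (m + 1) ^ 2 * (‖deriv g z‖ ^ 2 * ‖deriv h z‖ ^ 2 *
        ‖g z * deriv h z - h z * deriv g z‖ ^ 2)) := by
  -- The regrouping isolates the minors of $(F',F'')$ and $(F,F')$, which the Fubini–Study densities
  -- control; single second derivatives disappear.
  have e : fermatWedge m g h z
      = g z * h z * (deriv g z * deriv (deriv h) z - deriv h z * deriv (deriv g) z)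
        + ((m + 1 : ℕ) : ℂ) * (deriv g z * deriv h z * (g z * deriv h z - h z * deriv g z)) := by
    simp only [fermatWedge]
    push_cast
    ring
  rw [e]
  refine (sq_norm_add_le _ _).trans_eq ?_
  simp only [norm_mul, mul_pow, Complex.norm_natCast]
  push_cast
  ring

/-- On the Fermat surface the largest coordinate is bounded below. -/
theorem one_le_three_mul_sq_norm {n : ℕ} (hn : 2 ≤ n) {x y z : ℂ} (h : x ^ n + y ^ n + z ^ n = 1)
    (hy : ‖y‖ ≤ ‖x‖) (hz : ‖z‖ ≤ ‖x‖) : 1 ≤ 3 * ‖x‖ ^ 2 := by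
  by_contra! hc
  have hx1 : ‖x‖ ≤ 1 := by nlinarith [norm_nonneg x]
  have h1 : ‖x ^ n + y ^ n + z ^ n‖ ≤ ‖x‖ ^ n + ‖y‖ ^ n + ‖z‖ ^ n := by
    refine (norm_add_le _ _).trans (add_le_add ((norm_add_le _ _).trans ?_) ?_)
    · rw [norm_pow, norm_pow]
    · rw [norm_pow]
  rw [h, norm_one] at h1
  have h2 : ‖y‖ ^ n ≤ ‖x‖ ^ n := by gcongr
  have h3 : ‖z‖ ^ n ≤ ‖x‖ ^ n := by gcongr
  have h4 : ‖x‖ ^ n ≤ ‖x‖ ^ 2 := pow_le_pow_of_le_one (norm_nonneg x) hx1 hn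
  linarith

/-- The estimate of `xyz Φ` in the projective case. -/
theorem fermat_bound_projective {X Y Z N η θ D a b c W : ℝ} (hX : 0 < X) (hYX : Y ≤ X)
    (hZ : 0 ≤ Z) (hZX : Z ≤ X) (hN : 0 < N) (hNX : N ≤ 6 * X) (hη : 0 ≤ η) (hθ : 0 ≤ θ)
    (hb0 : 0 ≤ b) (hc0 : 0 ≤ c) (hD0 : 0 ≤ D)
    (ha : a ≤ η * N ^ 2) (hb : b ≤ η * N ^ 2) (hc : c ≤ η * N ^ 2)
    (hD : D ≤ θ * (N ^ 2 * (1 + 2 * η)) ^ 2) (hW : W ≤ 2 * (Y * Z * D + 49 * (a * b * c))) :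
    W / X ^ 6 ≤ 5000000 * ((1 + θ) * (1 + η) ^ 3) := by
  rw [div_le_iff₀ (by positivity)]
  have h1 : Y * Z * D ≤ X * X * (θ * ((6 * X) ^ 2 * (1 + 2 * η)) ^ 2) := by
    refine mul_le_mul (mul_le_mul hYX hZX hZ hX.le) (hD.trans ?_) hD0 (by positivity)
    -- With $X=|f|^2$ this term is of order $X\cdot X\cdot(X^2)^2=X^6=|f^6|^2$, exactly the
    -- denominator in degree $8$.
    gcongr
  have h2 : a * b * c ≤ (η * (6 * X) ^ 2) * (η * (6 * X) ^ 2) * (η * (6 * X) ^ 2) := by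
    have h : η * N ^ 2 ≤ η * (6 * X) ^ 2 := by gcongr
    exact mul_le_mul (mul_le_mul (ha.trans h) (hb.trans h) hb0 (by positivity)) (hc.trans h) hc0
      (by positivity)
  have h3 : 2 * (1296 * (θ * (1 + 2 * η) ^ 2) + 49 * 46656 * η ^ 3)
      ≤ 5000000 * ((1 + θ) * (1 + η) ^ 3) := by
    have e1 : θ * (1 + 2 * η) ^ 2 ≤ 4 * ((1 + θ) * (1 + η) ^ 3) := by
      have : (1 + 2 * η) ^ 2 ≤ 4 * (1 + η) ^ 3 := by nlinarith [mul_nonneg hη hη, pow_nonneg hη 3]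
      calc θ * (1 + 2 * η) ^ 2 ≤ (1 + θ) * (4 * (1 + η) ^ 3) := by
            gcongr; linarith
        _ = _ := by ring
    have e2 : η ^ 3 ≤ (1 + θ) * (1 + η) ^ 3 := by
      have h4 : η ^ 3 ≤ (1 + η) ^ 3 := by gcongr; linarith
      have h5 : (1 + η) ^ 3 ≤ (1 + θ) * (1 + η) ^ 3 :=
        le_mul_of_one_le_left (by positivity) (by linarith)
      linarith
    have e3 : 0 ≤ (1 + θ) * (1 + η) ^ 3 := by positivity
    linarith
  calc W ≤ 2 * (1296 * (θ * (1 + 2 * η) ^ 2) + 49 * 46656 * η ^ 3) * X ^ 6 := by linarith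
    _ ≤ _ := by gcongr

/-- The estimate of `xyz Φ` in the affine case. -/
theorem fermat_bound_affine {X Y Z N D D2 a b c d W : ℝ} (hX : 0 < X) (hYX : Y ≤ X)
    (hZ : 0 ≤ Z) (hZX : Z ≤ X) (hN : 0 < N) (hNX : N ≤ 6 * X) (hD : 0 ≤ D) (hD2 : 0 ≤ D2)
    (hb0 : 0 ≤ b) (hc0 : 0 ≤ c) (hd0 : 0 ≤ d)
    (ha : a ≤ D) (hb : b ≤ D) (hc : c ≤ 4 * (X * D)) (hd : d ≤ 4 * (D * D2))
    (hW : W ≤ 2 * (Y * Z * d + 25 * (a * b * c))) :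
    W / X ^ 4 ≤ 50000 * ((1 + D2 / N) * (1 + D / N) ^ 3) := by
  rw [div_le_iff₀ (by positivity)]
  -- In terms of the logarithmic quotients `p` and `q` every term is at most a constant times
  -- $X^4=|f^4|^2$, the denominator in degree $6$.
  obtain ⟨p, hp0, rfl⟩ : ∃ p, 0 ≤ p ∧ D = p * N := ⟨D / N, by positivity, by field_simp⟩
  obtain ⟨q, hq0, rfl⟩ : ∃ q, 0 ≤ q ∧ D2 = q * N := ⟨D2 / N, by positivity, by field_simp⟩
  rw [mul_div_cancel_right₀ _ hN.ne', mul_div_cancel_right₀ _ hN.ne']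
  have hpN : p * N ≤ p * (6 * X) := by gcongr
  have hqN : q * N ≤ q * (6 * X) := by gcongr
  have h1 : Y * Z * d ≤ X * X * (4 * ((p * (6 * X)) * (q * (6 * X)))) := by
    refine mul_le_mul (mul_le_mul hYX hZX hZ hX.le) (hd.trans ?_) hd0 (by positivity)
    gcongr
  have h2 : a * b * c ≤ (p * (6 * X)) * (p * (6 * X)) * (4 * (X * (p * (6 * X)))) := by
    refine mul_le_mul (mul_le_mul (ha.trans hpN) (hb.trans hpN) hb0 (by positivity)) (hc.trans ?_)
      hc0 (by positivity)
    gcongr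
  have h3 : 2 * (144 * (p * q) + 25 * 864 * p ^ 3) ≤ 50000 * ((1 + q) * (1 + p) ^ 3) := by
    have e1 : p * q ≤ (1 + q) * (1 + p) ^ 3 := by
      have : p ≤ (1 + p) ^ 3 := by nlinarith [mul_nonneg hp0 hp0, pow_nonneg hp0 3]
      calc p * q ≤ (1 + p) ^ 3 * (1 + q) := by gcongr; linarith
        _ = _ := by ring
    have e2 : p ^ 3 ≤ (1 + q) * (1 + p) ^ 3 := by
      have h4 : p ^ 3 ≤ (1 + p) ^ 3 := by gcongr; linarith
      have h5 : (1 + p) ^ 3 ≤ (1 + q) * (1 + p) ^ 3 :=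
        le_mul_of_one_le_left (by positivity) (by linarith)
      linarith
    have e3 : 0 ≤ (1 + q) * (1 + p) ^ 3 := by positivity
    linarith
  calc W ≤ 2 * (144 * (p * q) + 25 * 864 * p ^ 3) * X ^ 4 := by linarith
    _ ≤ _ := by gcongr

/-! ### From pointwise estimates to characteristic functions. -/

namespace FermatJet

theorem pullback_eq_zero {f g h : ℂ → ℂ} {n : ℕ} {z : ℂ} (H : f z = 0 ∨ g z = 0 ∨ h z = 0) :
    pullback ![f, g, h] (xyzPhi n) z = 0 := by
  rcases H with H | H | H <;> simp [pullback, xyzPhi, jetOf, H]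

/-- The characteristic function only depends on the function off a discrete set. -/
theorem charTFun_eq_circleAverage {p q : ℂ → ℂ} (hq : ∀ z, AnalyticAt ℂ q z)
    (hpq : ∀ᶠ z in codiscrete ℂ, p z = q z) {r : ℝ} (hr : 0 ≤ r) :
    charTFun p r = (circleAverage (fun z => log (1 + ‖q z‖ ^ 2)) 0 r - log (1 + ‖q 0‖ ^ 2)) / 2 := by
  have hqa : ∀ (_ : Fin 1) z, AnalyticAt ℂ q z := fun _ z => hq z
  have hc : Continuous (fsDensity (withOne fun _ : Fin 1 => q)) :=
    continuous_iff_continuousAt.2 fun z => (contDiffAt_fsDensity (n := 0)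
      (analyticAt_withOne fun i => hqa i z) (normSqSum_withOne_pos _ z).ne').continuousAt
  have h1 : charTFun p r = charT (fun _ : Fin 1 => q) r := by
    rw [charTFun, charT_eq_logIntegral hc (Eventually.of_forall fun _ => rfl) hr,
      charT_eq_logIntegral hc ?_ hr]
    filter_upwards [eventually_codiscrete_nhds hpq] with z hz
    refine fsDensity_congr fun o => ?_
    cases o with
    | none => exact EventuallyEq.rfl
    | some i => exact hz
  rw [h1, charT_eq_circleAverage hqa hr]
  simp only [normSqSum_withOne]
  simp [normSqSum]

theorem isBigOOutside_of_eventually_zero {f g h : ℂ → ℂ} {n : ℕ}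
    (H : ∀ᶠ z in codiscrete ℂ, f z = 0 ∨ g z = 0 ∨ h z = 0) (v : ℝ → ℝ) :
    IsBigOOutside (charTFun (pullback ![f, g, h] (xyzPhi n))) v := by
  refine ⟨∅, MeasurableSet.empty, empty_subset _, by simp, ?_⟩
  refine Asymptotics.IsBigO.mono (l' := atTop) ?_ inf_le_left
  refine EventuallyEq.trans_isBigO (f₂ := fun _ => (0 : ℝ)) ?_ (Asymptotics.isBigO_zero _ _)
  filter_upwards [eventually_ge_atTop 0] with r hr
  rw [charTFun_eq_circleAverage (q := fun _ => 0) (fun z => analyticAt_const)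
    (H.mono fun z hz => pullback_eq_zero hz) hr]
  simp [circleAverage_const]

/-- If the proximity function of a holomorphic function is small, so is its characteristic
function. -/
theorem isBigOOutside_charTFun {T : ℝ → ℝ} (hT : Tendsto T atTop atTop) {p q : ℂ → ℂ} {s : ℂ → ℝ}
    (hq : ∀ z, AnalyticAt ℂ q z) (hpq : ∀ᶠ z in codiscrete ℂ, p z = q z) (hs : Continuous s)
    (hps : ∀ᶠ z in codiscrete ℂ, log (1 + ‖p z‖ ^ 2) ≤ s z)
    (h : SmallOutside T fun r => circleAverage s 0 r) :
    IsBigOOutside (charTFun p) fun r => log (T r) := by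
  have hqc : Continuous q := continuous_iff_continuousAt.2 fun z => (hq z).continuousAt
  have hlog : Continuous fun z => log (1 + ‖q z‖ ^ 2) :=
    continuous_log_one_add (hqc.norm.pow 2) fun z => sq_nonneg _
  have hqs : ∀ z, log (1 + ‖q z‖ ^ 2) ≤ s z := le_of_eventually_codiscrete hlog hs <| by
    filter_upwards [hpq, hps] with z h1 h2
    rwa [← h1]
  refine SmallOutside.isBigOOutside (h.mono fun r hr => ?_)
    (fun r hr => charT_nonneg _ (by linarith)) hT
  rw [charTFun_eq_circleAverage hq hpq (by linarith)]
  have h1 := circleAverage_mono_of_continuous hlog hs hqs r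
  have h2 : 0 ≤ circleAverage (fun z => log (1 + ‖q z‖ ^ 2)) 0 r :=
    circleAverage_nonneg_of_nonneg' (fun z => log_nonneg (by nlinarith [sq_nonneg ‖q z‖])) r
  have h3 : 0 ≤ log (1 + ‖q 0‖ ^ 2) := log_nonneg (by nlinarith [sq_nonneg ‖q 0‖])
  linarith

/-- The characteristic function of a curve is unbounded unless the curve is constant. -/
theorem tendsto_charT_atTop {f g h : ℂ → ℂ} {n : ℕ} {η : ℂ → ℝ} (hη : Continuous η)
    (hd : ∀ᶠ z in codiscrete ℂ, fsDensity (withOne ![f, g, h]) z = η z)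
    (hM : ¬ ∀ᶠ z in codiscrete ℂ, pullback ![f, g, h] (M n) z = 0) :
    Tendsto (charT ![f, g, h]) atTop atTop := by
  have hη0 : ∀ z, 0 ≤ η z := le_of_eventually_codiscrete continuous_const hη
    (hd.mono fun z hz => hz ▸ fsDensity_nonneg _ z)
  have hne : ∃ a, η a ≠ 0 := by
    by_contra! hzero
    refine hM ?_
    have hder : ∀ᶠ z in codiscrete ℂ, ∀ i, deriv (![f, g, h] i) z = 0 := by
      filter_upwards [hd] with z hz i
      -- The minor with the constant coordinate is the derivative, so vanishing density makes the
      -- curve locally constant, and then the lower rows of $M_{xyz}$ vanish.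
      have h1 := sq_norm_wronskian_le_fsDensity (normSqSum_withOne_pos ![f, g, h] z) none (some i)
      rw [hz, hzero, zero_mul] at h1
      simpa [withOne] using pow_eq_zero_iff two_ne_zero |>.1 (le_antisymm h1 (sq_nonneg _))
    filter_upwards [eventually_codiscrete_nhds hder] with z hz
    have e1 : ∀ i, deriv (![f, g, h] i) z = 0 := hz.self_of_nhds
    have e2 : ∀ i, deriv (deriv (![f, g, h] i)) z = 0 := fun i => by
      have : deriv (![f, g, h] i) =ᶠ[𝓝 z] fun _ => 0 := hz.mono fun w hw => hw i
      rw [this.deriv_eq, deriv_const]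
    simp only [pullback, M, D2, jetOf, e1, e2]
    simp [Matrix.det_fin_three]
  obtain ⟨a, ha⟩ := hne
  refine ((tendsto_logIntegral_atTop hη hη0 ha).const_mul_atTop (inv_pos.2 pi_pos)).congr' ?_
  filter_upwards [eventually_ge_atTop 0] with r hr
  rw [charT_eq_logIntegral hη hd hr]

/-- The estimate of `xyz Φ` on a curve on the Fermat surface of degree `8`, where the first
coordinate is the largest. -/
theorem sq_norm_pullback_le_projective {f g h : ℂ → ℂ} {z : ℂ} (H : IsGoodPoint 6 f g h z)
    (hgf : ‖g z‖ ≤ ‖f z‖) (hhf : ‖h z‖ ≤ ‖f z‖) {N η θ : ℝ}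
    (hN : N = 1 + ‖f z‖ ^ 2 + ‖g z‖ ^ 2 + ‖h z‖ ^ 2) (hη : 0 ≤ η) (hθ : 0 ≤ θ)
    (hg' : ‖deriv g z‖ ^ 2 ≤ η * N ^ 2) (hh' : ‖deriv h z‖ ^ 2 ≤ η * N ^ 2)
    (hgh : ‖g z * deriv h z - h z * deriv g z‖ ^ 2 ≤ η * N ^ 2)
    (hgh' : ‖deriv g z * deriv (deriv h) z - deriv h z * deriv (deriv g) z‖ ^ 2
      ≤ θ * (N ^ 2 * (1 + 2 * η)) ^ 2) :
    -- The constant is a rounding of $2(4\cdot 1296+49\cdot 46656)$, where $49=(m+1)^2$, and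
    -- $1296=6^4$ and $46656=6^6$ come from $N\le 6|f|^2$.
    ‖pullback ![f, g, h] (xyzPhi 8) z‖ ^ 2 ≤ 5000000 * ((1 + θ) * (1 + η) ^ 3) := by
  have h1 := one_le_three_mul_sq_norm (by norm_num) H.rel.self_of_nhds hgf hhf
  have hg2 : ‖g z‖ ^ 2 ≤ ‖f z‖ ^ 2 := by gcongr
  have hh2 : ‖h z‖ ^ 2 ≤ ‖f z‖ ^ 2 := by gcongr
  have hX : 0 < ‖f z‖ ^ 2 := by linarith
  rw [pullback_xyzPhi_eq H.ne_x H.ne_y H.ne_z, norm_div, norm_pow, div_pow, ← pow_mul,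
    mul_comm 6 2, pow_mul]
  have hW := sq_norm_fermatWedge_le 6 g h z
  norm_num at hW
  exact fermat_bound_projective hX hg2 (sq_nonneg _) hh2 (by rw [hN]; positivity) (by linarith)
    hη hθ (sq_nonneg _) (sq_nonneg _) (sq_nonneg _) hg' hh' hgh hgh' hW

/-- The estimate of `xyz Φ` on a curve on the affine Fermat surface of degree `6`, where the first
coordinate is the largest. -/
theorem sq_norm_pullback_le_affine {f g h : ℂ → ℂ} {z : ℂ} (H : IsGoodPoint 4 f g h z)
    (hgf : ‖g z‖ ≤ ‖f z‖) (hhf : ‖h z‖ ≤ ‖f z‖) {N D D' : ℝ}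
    (hN : N = 1 + ‖f z‖ ^ 2 + ‖g z‖ ^ 2 + ‖h z‖ ^ 2)
    (hg' : ‖deriv g z‖ ^ 2 ≤ D) (hh' : ‖deriv h z‖ ^ 2 ≤ D)
    (hg'' : ‖deriv (deriv g) z‖ ^ 2 ≤ D') (hh'' : ‖deriv (deriv h) z‖ ^ 2 ≤ D') :
    ‖pullback ![f, g, h] (xyzPhi 6) z‖ ^ 2 ≤ 50000 * ((1 + D' / N) * (1 + D / N) ^ 3) := by
  have h1 := one_le_three_mul_sq_norm (by norm_num) H.rel.self_of_nhds hgf hhf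
  have hg2 : ‖g z‖ ^ 2 ≤ ‖f z‖ ^ 2 := by gcongr
  have hh2 : ‖h z‖ ^ 2 ≤ ‖f z‖ ^ 2 := by gcongr
  have hX : 0 < ‖f z‖ ^ 2 := by linarith
  have hD : 0 ≤ D := (sq_nonneg _).trans hg'
  have hD' : 0 ≤ D' := (sq_nonneg _).trans hg''
  have hgh : ‖g z * deriv h z - h z * deriv g z‖ ^ 2 ≤ 4 * (‖f z‖ ^ 2 * D) := by
    refine (sq_norm_sub_le _ _).trans ?_
    rw [norm_mul, norm_mul, mul_pow, mul_pow]
    have e1 : ‖g z‖ ^ 2 * ‖deriv h z‖ ^ 2 ≤ ‖f z‖ ^ 2 * D := by gcongr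
    have e2 : ‖h z‖ ^ 2 * ‖deriv g z‖ ^ 2 ≤ ‖f z‖ ^ 2 * D := by gcongr
    linarith
  have hgh' : ‖deriv g z * deriv (deriv h) z - deriv h z * deriv (deriv g) z‖ ^ 2
      ≤ 4 * (D * D') := by
    refine (sq_norm_sub_le _ _).trans ?_
    rw [norm_mul, norm_mul, mul_pow, mul_pow]
    have e1 : ‖deriv g z‖ ^ 2 * ‖deriv (deriv h) z‖ ^ 2 ≤ D * D' := by gcongr
    have e2 : ‖deriv h z‖ ^ 2 * ‖deriv (deriv g) z‖ ^ 2 ≤ D * D' := by gcongr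
    linarith
  rw [pullback_xyzPhi_eq H.ne_x H.ne_y H.ne_z, norm_div, norm_pow, div_pow, ← pow_mul,
    mul_comm 4 2, pow_mul]
  have hW := sq_norm_fermatWedge_le 4 g h z
  norm_num at hW
  exact fermat_bound_affine hX hg2 (sq_nonneg _) hh2 (by rw [hN]; positivity) (by linarith)
    hD hD' (sq_nonneg _) (sq_nonneg _) (sq_nonneg _) hg' hh' hgh hgh' hW

theorem exists_max_of_three (a b c : ℝ) :
    (b ≤ a ∧ c ≤ a) ∨ (c ≤ b ∧ a ≤ b) ∨ (a ≤ c ∧ b ≤ c) := by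
  grind

theorem normSqSum_withOne_three (f g h : ℂ → ℂ) (z : ℂ) :
    normSqSum (withOne ![f, g, h]) z = 1 + ‖f z‖ ^ 2 + ‖g z‖ ^ 2 + ‖h z‖ ^ 2 := by
  rw [normSqSum_withOne]
  simp [normSqSum, Fin.sum_univ_three, add_assoc]

/-! ### The two cases of the theorem. -/

/-- The case of entire curves on the Fermat surface of degree `6`. -/
theorem isBigOOutside_of_entire {f g h : ℂ → ℂ} (hf : Differentiable ℂ f)
    (hg : Differentiable ℂ g) (hh : Differentiable ℂ h)
    (hrel : ∀ ζ, f ζ ^ 6 + g ζ ^ 6 + h ζ ^ 6 = 1)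
    (hM : ¬ ∀ᶠ ζ in codiscrete ℂ, pullback ![f, g, h] (M 6) ζ = 0) :
    IsBigOOutside (charTFun (pullback ![f, g, h] (xyzPhi 6)))
      fun r => log (charT ![f, g, h] r) := by
  have hfa : ∀ z, AnalyticAt ℂ f z := fun z => hf.analyticAt z
  have hga : ∀ z, AnalyticAt ℂ g z := fun z => hg.analyticAt z
  have hha : ∀ z, AnalyticAt ℂ h z := fun z => hh.analyticAt z
  have hF : ∀ i z, AnalyticAt ℂ (![f, g, h] i) z := by
    intro i z
    fin_cases i
    exacts [hfa z, hga z, hha z]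
  rcases Meromorphic.eventually_zero_or_ne_zero fun z => (hfa z).meromorphicAt with hf0 | hf0
  · exact isBigOOutside_of_eventually_zero (hf0.mono fun z hz => Or.inl hz) _
  rcases Meromorphic.eventually_zero_or_ne_zero fun z => (hga z).meromorphicAt with hg0 | hg0
  · exact isBigOOutside_of_eventually_zero (hg0.mono fun z hz => Or.inr (Or.inl hz)) _
  rcases Meromorphic.eventually_zero_or_ne_zero fun z => (hha z).meromorphicAt with hh0 | hh0
  · exact isBigOOutside_of_eventually_zero (hh0.mono fun z hz => Or.inr (Or.inr hz)) _
  have hgood : ∀ᶠ z in codiscrete ℂ, IsGoodPoint 4 f g h z := by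
    filter_upwards [hf0, hg0, hh0] with z h1 h2 h3
    exact ⟨hfa z, hga z, hha z, h1, h2, h3, Eventually.of_forall hrel⟩
  obtain ⟨q, hq, hpq⟩ := exists_entire_extension (p := pullback ![f, g, h] (xyzPhi 6)) fun a =>
    exists_analyticAt_of_analyticAt (m := 4) (hfa a) (hga a) (hha a)
      (eventually_codiscrete_iff.1 hgood a)
  have hηc : Continuous (fsDensity (withOne ![f, g, h])) :=
    continuous_iff_continuousAt.2 fun z => (contDiffAt_fsDensity (n := 0)
      (analyticAt_withOne fun i => hF i z) (normSqSum_withOne_pos _ z).ne').continuousAt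
  have hT := tendsto_charT_atTop hηc (Eventually.of_forall fun _ => rfl) hM
  have hT0 : ∀ r, 1 < r → 0 ≤ charT ![f, g, h] r := fun r hr => charT_nonneg _ (by linarith)
  have s1 := SmallOutside.log_deriv hF
  have s2 := SmallOutside.log_deriv_deriv hF
  set N := normSqSum (withOne ![f, g, h]) with hN
  set D := normSqSum fun i => deriv (![f, g, h] i) with hD
  set D' := normSqSum fun i => deriv (deriv (![f, g, h] i)) with hD'
  have hN0 : ∀ z, 0 < N z := normSqSum_withOne_pos _
  have hNc : Continuous N := continuous_normSqSum fun o z => analyticAt_withOne (fun i => hF i z) o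
  have hd0 : ∀ z, 0 ≤ D z / N z := fun z => div_nonneg (normSqSum_nonneg _ z) (hN0 z).le
  have hd0' : ∀ z, 0 ≤ D' z / N z := fun z => div_nonneg (normSqSum_nonneg _ z) (hN0 z).le
  have c1 : Continuous fun z => log (1 + D z / N z) := continuous_log_one_add
    ((continuous_normSqSum fun i z => (hF i z).deriv).div hNc fun z => (hN0 z).ne') hd0
  have c2 : Continuous fun z => log (1 + D' z / N z) := continuous_log_one_add
    ((continuous_normSqSum fun i z => (hF i z).deriv.deriv).div hNc fun z => (hN0 z).ne') hd0'
  -- The logarithm of the pointwise bound; raising the constant by one absorbs the $1$ in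
  -- $\log(1+|q|^2)$.
  refine isBigOOutside_charTFun hT hq hpq (s := fun z => (log 50001 + log (1 + D' z / N z))
    + ((log (1 + D z / N z) + log (1 + D z / N z)) + log (1 + D z / N z))) (by fun_prop) ?_ ?_
  · filter_upwards [hgood] with z hz
    have b1 : ∀ i, ‖deriv (![f, g, h] i) z‖ ^ 2 ≤ D z := sq_norm_le_normSqSum _ z
    have b2 : ∀ i, ‖deriv (deriv (![f, g, h] i)) z‖ ^ 2 ≤ D' z := sq_norm_le_normSqSum _ z
    have e1 := normSqSum_withOne_three f g h z
    rw [← hN] at e1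
    have key : ‖pullback ![f, g, h] (xyzPhi 6) z‖ ^ 2
        ≤ 50000 * ((1 + D' z / N z) * (1 + D z / N z) ^ 3) := by
      rcases exists_max_of_three ‖f z‖ ‖g z‖ ‖h z‖ with ⟨h1, h2⟩ | ⟨h1, h2⟩ | ⟨h1, h2⟩
      · exact sq_norm_pullback_le_affine hz h1 h2 e1 (b1 1) (b1 2) (b2 1) (b2 2)
      · rw [hz.pullback_cyclic]
        exact sq_norm_pullback_le_affine hz.cyclic h1 h2 (by rw [e1]; ring) (b1 2) (b1 0) (b2 2)
          (b2 0)
      · rw [hz.pullback_cyclic, hz.cyclic.pullback_cyclic]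
        exact sq_norm_pullback_le_affine hz.cyclic.cyclic h1 h2 (by rw [e1]; ring) (b1 0) (b1 1)
          (b2 0) (b2 1)
    have p1 := hd0 z
    have p2 := hd0' z
    rw [← log_mul (by positivity) (by positivity), ← log_mul (by positivity) (by positivity),
      ← log_mul (by positivity) (by positivity), ← log_mul (by positivity) (by positivity)]
    refine log_le_log (by positivity) ?_
    have : 1 ≤ (1 + D' z / N z) * (1 + D z / N z) ^ 3 :=
      one_le_mul_of_one_le_of_one_le (by linarith) (one_le_pow₀ (by linarith))
    linarith
  · exact (SmallOutside.circleAverage_add hT0 continuous_const c2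
      ((SmallOutside.const hT0 (log 50001)).mono fun r _ => (circleAverage_const _ _ _).le)
      s2).circleAverage_add hT0 (by fun_prop) (by fun_prop)
      ((s1.circleAverage_add hT0 c1 c1 s1).circleAverage_add hT0 (by fun_prop) c1 s1)

/-- The case of meromorphic curves on the Fermat surface of degree `8`. -/
theorem isBigOOutside_of_meromorphic {f g h : ℂ → ℂ} (hf : Meromorphic f)
    (hg : Meromorphic g) (hh : Meromorphic h)
    (hrel : ∀ᶠ ζ in codiscrete ℂ, f ζ ^ 8 + g ζ ^ 8 + h ζ ^ 8 = 1)
    (hM : ¬ ∀ᶠ ζ in codiscrete ℂ, pullback ![f, g, h] (M 8) ζ = 0) :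
    IsBigOOutside (charTFun (pullback ![f, g, h] (xyzPhi 8)))
      fun r => log (charT ![f, g, h] r) := by
  rcases hf.eventually_zero_or_ne_zero with hf0 | hf0
  · exact isBigOOutside_of_eventually_zero (hf0.mono fun z hz => Or.inl hz) _
  rcases hg.eventually_zero_or_ne_zero with hg0 | hg0
  · exact isBigOOutside_of_eventually_zero (hg0.mono fun z hz => Or.inr (Or.inl hz)) _
  rcases hh.eventually_zero_or_ne_zero with hh0 | hh0
  · exact isBigOOutside_of_eventually_zero (hh0.mono fun z hz => Or.inr (Or.inr hz)) _
  have han : ∀ {k : ℂ → ℂ}, Meromorphic k → ∀ᶠ z in codiscrete ℂ, AnalyticAt ℂ k z := fun hk =>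
    eventually_codiscrete_iff.2 fun a => (hk a).eventually_analyticAt
  have hgood : ∀ᶠ z in codiscrete ℂ, IsGoodPoint 6 f g h z := by
    filter_upwards [han hf, han hg, han hh, hf0, hg0, hh0, eventually_codiscrete_nhds hrel] with z
      h1 h2 h3 h4 h5 h6 h7
    exact ⟨h1, h2, h3, h4, h5, h6, h7⟩
  -- The local models of $xyz\Phi$ and of the density glue to an entire function and a $C^2$
  -- function, as the integral formulas require.
  have hloc := fun a => exists_local_extension (hf a) (hg a) (hh a)
    (eventually_codiscrete_iff.1 hgood a)
  obtain ⟨q, hq, hpq⟩ := exists_entire_extension fun a => (hloc a).1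
  obtain ⟨η, hη, hd⟩ := exists_contDiff_extension fun a => (hloc a).2
  have hF : ∀ᶠ z in codiscrete ℂ, ∀ i, AnalyticAt ℂ (![f, g, h] i) z := by
    filter_upwards [hgood] with z hz i
    fin_cases i
    exacts [hz.analytic_x, hz.analytic_y, hz.analytic_z]
  have hT := tendsto_charT_atTop hη.continuous hd hM
  have hT0 : ∀ r, 1 < r → 0 ≤ charT ![f, g, h] r := fun r hr => charT_nonneg _ (by linarith)
  obtain ⟨s1, θ, hθc, hθ0, hθd, s2⟩ := exists_fsDensity_associatedCurve_extension hη hd hF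
  have hη0 : ∀ z, 0 ≤ η z := le_of_eventually_codiscrete continuous_const hη.continuous
    (hd.mono fun z hz => hz ▸ fsDensity_nonneg _ z)
  have c1 := continuous_log_one_add hη.continuous hη0
  have c2 := continuous_log_one_add hθc hθ0
  refine isBigOOutside_charTFun hT hq hpq (s := fun z => (log 5000001 + log (1 + θ z))
    + ((log (1 + η z) + log (1 + η z)) + log (1 + η z))) (by fun_prop) ?_ ?_
  · filter_upwards [hgood, hd, hθd] with z hz hdz hθz
    have hpos := normSqSum_withOne_pos ![f, g, h] z
    have e1 := normSqSum_withOne_three f g h z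
    have b1 : ∀ i, ‖deriv (![f, g, h] i) z‖ ^ 2
        ≤ η z * normSqSum (withOne ![f, g, h]) z ^ 2 := by
      intro i
      have := sq_norm_wronskian_le_fsDensity hpos none (some i)
      rw [hdz] at this
      simpa [withOne] using this
    have b2 : ∀ i j, ‖![f, g, h] i z * deriv (![f, g, h] j) z
        - ![f, g, h] j z * deriv (![f, g, h] i) z‖ ^ 2
        ≤ η z * normSqSum (withOne ![f, g, h]) z ^ 2 := by
      intro i j
      have := sq_norm_wronskian_le_fsDensity hpos (some i) (some j)
      rwa [hdz] at this
    have b3 : ∀ i j, ‖deriv (![f, g, h] i) z * deriv (deriv (![f, g, h] j)) z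
        - deriv (![f, g, h] j) z * deriv (deriv (![f, g, h] i)) z‖ ^ 2
        ≤ θ z * (normSqSum (withOne ![f, g, h]) z ^ 2 * (1 + 2 * η z)) ^ 2 := by
      intro i j
      have := sq_norm_deriv_wronskian_le ![f, g, h] z i j
      rwa [hθz, hdz] at this
    have p1 := hη0 z
    have p2 := hθ0 z
    have key : ‖pullback ![f, g, h] (xyzPhi 8) z‖ ^ 2
        ≤ 5000000 * ((1 + θ z) * (1 + η z) ^ 3) := by
      rcases exists_max_of_three ‖f z‖ ‖g z‖ ‖h z‖ with ⟨h1, h2⟩ | ⟨h1, h2⟩ | ⟨h1, h2⟩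
      · exact sq_norm_pullback_le_projective hz h1 h2 e1 p1 p2 (b1 1) (b1 2) (b2 1 2) (b3 1 2)
      · rw [hz.pullback_cyclic]
        exact sq_norm_pullback_le_projective hz.cyclic h1 h2 (by rw [e1]; ring) p1 p2 (b1 2) (b1 0)
          (b2 2 0) (b3 2 0)
      · rw [hz.pullback_cyclic, hz.cyclic.pullback_cyclic]
        exact sq_norm_pullback_le_projective hz.cyclic.cyclic h1 h2 (by rw [e1]; ring) p1 p2 (b1 0)
          (b1 1) (b2 0 1) (b3 0 1)
    rw [← log_mul (by positivity) (by positivity), ← log_mul (by positivity) (by positivity),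
      ← log_mul (by positivity) (by positivity), ← log_mul (by positivity) (by positivity)]
    refine log_le_log (by positivity) ?_
    have : 1 ≤ (1 + θ z) * (1 + η z) ^ 3 :=
      one_le_mul_of_one_le_of_one_le (by linarith) (one_le_pow₀ (by linarith))
    linarith
  · exact (SmallOutside.circleAverage_add hT0 continuous_const c2
      ((SmallOutside.const hT0 (log 5000001)).mono fun r _ => (circleAverage_const _ _ _).le)
      s2).circleAverage_add hT0 (by fun_prop) (by fun_prop)
      ((s1.circleAverage_add hT0 c1 c1 s1).circleAverage_add hT0 (by fun_prop) c1 s1)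

end FermatJet

theorem proposition5p1 (f g h : ℂ → ℂ) :
    -- (a) `n = 6`, entire functions
    (Differentiable ℂ f → Differentiable ℂ g → Differentiable ℂ h →
      (∀ ζ, f ζ ^ 6 + g ζ ^ 6 + h ζ ^ 6 = 1) →
      ¬ (∀ᶠ ζ in Filter.codiscrete ℂ, FermatJet.pullback ![f, g, h] (FermatJet.M 6) ζ = 0) →
      FermatJet.IsBigOOutside
        (FermatJet.charTFun (FermatJet.pullback ![f, g, h] (FermatJet.xyzPhi 6)))
        (fun r => Real.log (FermatJet.charT ![f, g, h] r))) ∧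
    -- (b) `n = 8`, meromorphic functions
    (Meromorphic f → Meromorphic g → Meromorphic h →
      (∀ᶠ ζ in Filter.codiscrete ℂ, f ζ ^ 8 + g ζ ^ 8 + h ζ ^ 8 = 1) →
      ¬ (∀ᶠ ζ in Filter.codiscrete ℂ, FermatJet.pullback ![f, g, h] (FermatJet.M 8) ζ = 0) →
      FermatJet.IsBigOOutside
        (FermatJet.charTFun (FermatJet.pullback ![f, g, h] (FermatJet.xyzPhi 8)))
        (fun r => Real.log (FermatJet.charT ![f, g, h] r))) :=
  ⟨FermatJet.isBigOOutside_of_entire, FermatJet.isBigOOutside_of_meromorphic⟩
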